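/- Let $\mathbb D$ be the open unit disc in $\mathbb C$ and $m$ planar Lebesgue measure. Let $p>0$, let $\eta_1,\dots,\eta_n$ be distinct points of the unit circle ($n\ge 0$), let $q_1,\dots,q_n\in\mathbb R$, and set $R(z)=\prod_{j=1}^n (z-\eta_j)^{q_j}$, so that $|R(z)|=\prod_{j=1}^n|z-\eta_j|^{q_j}$ for $z\in\mathbb D$. For $f$ holomorphic in $\mathbb D$ and $0<\delta<1$ put $$\|f\|_{\mathcal N_{|R|,p},\delta}:=\sup_{1-\delta<s<1}\int_{\mathbb D}(1-|z|^2)^{p-1}\,|R(sz)|\,\log^+|f(sz)|\,dm(z)\in[0,\infty],$$ and say that $f$ belongs to the generalised Nevanlinna class $\mathcal N_{|R|,p}(\mathbb D)$ if $\|f\|_{\mathcal N_{|R|,p},\delta}<\infty$ for some $\delta\in(0,1)$. For each $j$ let $\tilde q_j=q_j$ if $q_j>-p/2$, and let $\tilde q_j$ be any real number with $\tilde q_j>-p/2$ otherwise; set $\tilde R(z)=\prod_{j=1}^n(z-\eta_j)^{\tilde q_j}$. Then there is a finite constant $c=c(p,\tilde q,R)\ge 0$, depending only on $p$, $\tilde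 q$ and $R$, such that for every $f\in\mathcal N_{|R|,p}(\mathbb D)$ with $|f(0)|=1$ and every $\delta\in(0,1)$ with $\|f\|_{\mathcal N_{|R|,p},\delta}<\infty$, $$\sum_{a\in Z(f)}(1-|a|^2)^{1+p}\,|\tilde R(a)|\le c\,\|f\|_{\mathcal N_{|R|,p},\delta},$$ where $Z(f)$ is the sequence of zeros of $f$ in $\mathbb D$, each repeated according to its multiplicity. -/

import Mathlib

noncomputable section

/-- The modulus `|R(z)| = ∏_j |z - η_j|^{q_j}` of `R(z) = ∏_j (z - η_j)^{q_j}`. As the exponents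
are real, the modulus does not depend on the branches chosen for the powers. -/
def absR {n : ℕ} (η : Fin n → ℂ) (q : Fin n → ℝ) (z : ℂ) : ℝ :=
  ∏ j, ‖z - η j‖ ^ q j

/-- The quantity `‖f‖_{N_{φ,p}}`, computed with the parameter `δ`:
`sup_{1-δ<s<1} ∫_𝔻 (1-|z|²)^{p-1} φ(sz) log⁺|f(sz)| dm(z)`, with values in `[0, ∞]`;
`m` is the planar Lebesgue measure. -/
def nevanlinnaNorm (φ : ℂ → ℝ) (p δ : ℝ) (f : ℂ → ℂ) : ENNReal :=
  ⨆ s ∈ Set.Ioo (1 - δ) 1, ∫⁻ z in Metric.ball (0 : ℂ) 1,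
    ENNReal.ofReal ((1 - ‖z‖ ^ 2) ^ (p - 1) * φ ((s : ℂ) * z) * Real.posLog ‖f ((s : ℂ) * z)‖)

/-- The generalised Nevanlinna class `N_{φ,p}(𝔻)`: holomorphic functions in the unit disc with
`‖f‖_{N_{φ,p}} < ∞` for some parameter `0 < δ < 1`. -/
def nevanlinnaClass (φ : ℂ → ℝ) (p : ℝ) : Set (ℂ → ℂ) :=
  {f | DifferentiableOn ℂ f (Metric.ball 0 1) ∧
    ∃ δ ∈ Set.Ioo (0 : ℝ) 1, nevanlinnaNorm φ p δ f < ⊤}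

/-- `∑_{a ∈ Z(f)} w(a)`, where `Z(f)` is the sequence of zeros of `f` in the unit disc, each
repeated according to its multiplicity, for a nonnegative function `w`. -/
def zeroSum (f : ℂ → ℂ) (w : ℂ → ℝ) : ENNReal :=
  ∑' a : {a : ℂ // a ∈ Metric.ball (0 : ℂ) 1 ∧ f a = 0},
    (analyticOrderNatAt f a : ENNReal) * ENNReal.ofReal (w a)

end

/-!
The exponents at which `q j ≤ -p / 2` are raised to `q' j` first: on the disc `absR η q'` is at most
a constant times `absR η q`, so it suffices to treat weights all of whose exponents exceed `-p / 2`.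

Fix `s < 1` and put `g z = f (s z)`, `ρ z = absR η q' (s z)`, `v = 1 - |z|²`. The zeros of `g` are
tested against `φ = F(v) ρ`, where `F` is a `C²` version of `v ^ (1 + p)` that vanishes for `v ≤ ε`
and satisfies `p F' ≤ v F''` and `F'' ≤ v ^ (p - 1)` (`profile`). The Riesz formula
(`AnalyticOnNhd.sum_zeros_le_integral`) bounds `2π ∑ φ(a)` by `∫ log |g| Δφ`. Since `log ρ` is the
real part of a holomorphic function with derivative `L = ∑ q'_j s / (s z - η_j)`,
`Δφ = ρ (4 |z|² F'' - 4 F' - 4 F' Re (z L) + F |L|²)`, with two consequences, both uniform in `s`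
and `ε`.

* `|Δφ| ≤ C v ^ (p - 1) ρ`, because `|L| ≤ C / v` (`abs_laplacianFactor_le`).
* `Δφ ≥ 0` near the unit circle (`laplacianFactor_nonneg`). Here the bound `-p / 2` enters: only
  negative exponents make `Re (z L)` large, each point of the disc is close to at most one `η_j`,
  and the contribution of that `η_j` is at most `2 κ / v` with `κ < p / 2`, so that the term
  `4 F' Re (z L)` is absorbed by `4 |z|² F'' ≥ 4 p |z|² F' / v`.

On a smaller disc `|z| < r` a constant `B` is added to make `Δφ + B` nonnegative there as well. This
does not decrease the integral, since `∫_{|z| < r} log |g| ≥ 0` by Jensen's formula and `|g 0| = 1`.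
Now `log |g|` may be replaced by `log⁺ |g|`, and the weight is at most a constant times
`v ^ (p - 1) ρ`. This gives the inequality for `g` (`exists_sum_zeros_le`), and `s → 1` over finite
sets of zeros gives it for `f`.
-/

open MeasureTheory Set Filter Topology

/-! ### The radial profile -/

/-- The second derivative `F''` of the radial profile: a continuous function that vanishes for
`u ≤ ε` and equals `u ^ (p - 1)` for `u ≥ 2 ε`, being `u ^ (p - 1)` times a nondecreasing cutoff.
In the power, `u` is replaced by `max u ε` to keep the function continuous at `0`. -/
noncomputable def profileDeriv2 (p ε u : ℝ) : ℝ := max 0 (min 1 (u / ε - 1)) * max u ε ^ (p - 1)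

section profile
variable {p ε : ℝ}

theorem continuous_profileDeriv2 (hε : 0 < ε) : Continuous (profileDeriv2 p ε) := by
  unfold profileDeriv2
  refine Continuous.mul (by fun_prop) ?_
  refine Continuous.rpow_const (by fun_prop) fun x => Or.inl ?_
  exact (lt_of_lt_of_le hε (le_max_right _ _)).ne'

theorem profileDeriv2_nonneg (hε : 0 < ε) (u : ℝ) : 0 ≤ profileDeriv2 p ε u :=
  mul_nonneg (le_max_left _ _) (Real.rpow_nonneg (hε.le.trans (le_max_right _ _)) _)

theorem profileDeriv2_eq_zero (hε : 0 < ε) {u : ℝ} (hu : u ≤ ε) : profileDeriv2 p ε u = 0 := by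
  have : u / ε ≤ 1 := by rwa [div_le_one hε]
  have h : min 1 (u / ε - 1) ≤ 0 := (min_le_right _ _).trans (by linarith)
  simp [profileDeriv2, max_eq_left h]

theorem profileDeriv2_eq_rpow (hε : 0 < ε) {u : ℝ} (hu : 2 * ε ≤ u) :
    profileDeriv2 p ε u = u ^ (p - 1) := by
  have h1 : 1 ≤ u / ε - 1 := by
    have : 2 ≤ u / ε := by rwa [le_div_iff₀ hε]
    linarith
  rw [profileDeriv2, min_eq_left h1, max_eq_right zero_le_one, one_mul, max_eq_left (by linarith)]

/-- The cutoff in `profileDeriv2` is nondecreasing, so its value at `v` bounds it to the left of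
`v`. -/
theorem profileDeriv2_le_of_le (hε : 0 < ε) {u v : ℝ} (hu : 0 < u) (huv : u ≤ v) :
    profileDeriv2 p ε u ≤ u ^ (p - 1) * max 0 (min 1 (v / ε - 1)) := by
  rcases le_or_gt u ε with h | h
  · rw [profileDeriv2_eq_zero hε h]
    exact mul_nonneg (Real.rpow_nonneg hu.le _) (le_max_left _ _)
  · rw [profileDeriv2, max_eq_left h.le, mul_comm]
    gcongr

theorem profileDeriv2_le (hε : 0 < ε) {u : ℝ} (hu : 0 < u) :
    profileDeriv2 p ε u ≤ u ^ (p - 1) := by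
  refine (profileDeriv2_le_of_le hε hu le_rfl).trans ?_
  refine mul_le_of_le_one_right (Real.rpow_nonneg hu.le _) ?_
  exact max_le zero_le_one (min_le_left _ _)

/-- The first derivative `F'` of the radial profile. -/
noncomputable def profileDeriv (p ε v : ℝ) : ℝ := ∫ u in (0 : ℝ)..v, profileDeriv2 p ε u

/-- The radial profile `F`: a `C²` function that vanishes for `v ≤ ε` and is comparable to
`v ^ (1 + p)` for `v ≥ 4 ε`, with constants independent of `ε`. -/
noncomputable def profile (p ε v : ℝ) : ℝ := ∫ u in (0 : ℝ)..v, profileDeriv p ε u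

theorem hasDerivAt_profileDeriv (hε : 0 < ε) (v : ℝ) :
    HasDerivAt (profileDeriv p ε) (profileDeriv2 p ε v) v :=
  (continuous_profileDeriv2 hε).integral_hasStrictDerivAt 0 v |>.hasDerivAt

theorem continuous_profileDeriv (hε : 0 < ε) : Continuous (profileDeriv p ε) :=
  continuous_iff_continuousAt.2 fun v => (hasDerivAt_profileDeriv hε v).continuousAt

theorem hasDerivAt_profile (hε : 0 < ε) (v : ℝ) :
    HasDerivAt (profile p ε) (profileDeriv p ε v) v :=
  (continuous_profileDeriv hε).integral_hasStrictDerivAt 0 v |>.hasDerivAt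

theorem continuous_profile (hε : 0 < ε) : Continuous (profile p ε) :=
  continuous_iff_continuousAt.2 fun v => (hasDerivAt_profile hε v).continuousAt

theorem uIcc_zero_subset_Iic {v : ℝ} (hε : 0 < ε) (hv : v ≤ ε) : uIcc 0 v ⊆ Iic ε := fun u hu => by
  rcases le_total 0 v with h | h
  · rw [uIcc_of_le h] at hu; exact hu.2.trans hv
  · rw [uIcc_of_ge h] at hu; exact hu.2.trans hε.le

theorem profileDeriv_eq_zero (hε : 0 < ε) {v : ℝ} (hv : v ≤ ε) : profileDeriv p ε v = 0 := by
  rw [profileDeriv, intervalIntegral.integral_congr (g := fun _ => 0)]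
  · simp
  · exact fun u hu => profileDeriv2_eq_zero hε (uIcc_zero_subset_Iic hε hv hu)

theorem profile_eq_zero (hε : 0 < ε) {v : ℝ} (hv : v ≤ ε) : profile p ε v = 0 := by
  rw [profile, intervalIntegral.integral_congr (g := fun _ => 0)]
  · simp
  · exact fun u hu => profileDeriv_eq_zero hε (uIcc_zero_subset_Iic hε hv hu)

theorem monotone_profileDeriv (hε : 0 < ε) : Monotone (profileDeriv p ε) :=
  monotone_of_hasDerivAt_nonneg (hasDerivAt_profileDeriv hε) (profileDeriv2_nonneg hε)

theorem profileDeriv_nonneg (hε : 0 < ε) (v : ℝ) : 0 ≤ profileDeriv p ε v := by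
  rcases le_total v 0 with h | h
  · exact (profileDeriv_eq_zero hε (h.trans hε.le)).ge
  · exact (profileDeriv_eq_zero hε hε.le).ge.trans (monotone_profileDeriv hε h)

theorem profile_nonneg (hε : 0 < ε) (v : ℝ) : 0 ≤ profile p ε v := by
  have hm : Monotone (profile p ε) :=
    monotone_of_hasDerivAt_nonneg (hasDerivAt_profile hε) (profileDeriv_nonneg hε)
  rcases le_total v 0 with h | h
  · exact (profile_eq_zero hε (h.trans hε.le)).ge
  · exact (profile_eq_zero hε hε.le).ge.trans (hm h)

/-- The differential inequality `p F' ≤ v F''`, an equality for `F = v ^ (1 + p)`. It holds because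
`F''` is `v ^ (p - 1)` times a nondecreasing function. -/
theorem mul_profileDeriv_le (hp : 0 < p) (hε : 0 < ε) {v : ℝ} (hv : 0 < v) :
    p * profileDeriv p ε v ≤ v * profileDeriv2 p ε v := by
  rcases le_or_gt v ε with h | h
  · rw [profileDeriv_eq_zero hε h, profileDeriv2_eq_zero hε h]; simp
  have key : profileDeriv p ε v ≤ ∫ u in (0 : ℝ)..v, u ^ (p - 1) * max 0 (min 1 (v / ε - 1)) := by
    refine intervalIntegral.integral_mono_on_of_le_Ioo hv.le
      ((continuous_profileDeriv2 hε).intervalIntegrable _ _) ?_ ?_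
    · exact (intervalIntegral.intervalIntegrable_rpow' (by linarith)).mul_const _
    · exact fun u hu => profileDeriv2_le_of_le hε hu.1 hu.2.le
  rw [intervalIntegral.integral_mul_const, integral_rpow (Or.inl (by linarith))] at key
  rw [profileDeriv2, max_eq_left h.le, Real.rpow_sub_one hv.ne']
  simp only [sub_add_cancel, Real.zero_rpow hp.ne', sub_zero] at key
  calc p * profileDeriv p ε v ≤ p * (v ^ p / p * max 0 (min 1 (v / ε - 1))) := by gcongr
    _ = _ := by field_simp

theorem mul_profileDeriv_le_rpow (hp : 0 < p) (hε : 0 < ε) {v : ℝ} (hv : 0 < v) :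
    p * profileDeriv p ε v ≤ v * v ^ (p - 1) :=
  (mul_profileDeriv_le hp hε hv).trans (by gcongr; exact profileDeriv2_le hε hv)

theorem profile_le (hε : 0 < ε) {v : ℝ} (hv : 0 < v) : profile p ε v ≤ v * profileDeriv p ε v := by
  have : profile p ε v ≤ ∫ u in (0 : ℝ)..v, profileDeriv p ε v :=
    intervalIntegral.integral_mono_on hv.le ((continuous_profileDeriv hε).intervalIntegrable _ _)
      (by simp) fun u hu => monotone_profileDeriv hε hu.2
  simpa using this

/-- The lower bound `F v ≥ c v ^ (1 + p)` for `v ≥ 4 ε`, with `c` independent of `ε`. -/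
theorem rpow_le_profile (hε : 0 < ε) {v : ℝ} (hv : 4 * ε ≤ v) :
    min 1 ((1 / 2 : ℝ) ^ (p - 1)) / 16 * v ^ (1 + p) ≤ profile p ε v := by
  have hv0 : 0 < v := by linarith
  set c : ℝ := min 1 ((1 / 2 : ℝ) ^ (p - 1)) with hc
  have hc0 : 0 ≤ c := le_min zero_le_one (by positivity)
  have hk : ∀ u ∈ Icc (v / 2) v, c * v ^ (p - 1) ≤ profileDeriv2 p ε u := fun u hu => by
    have hu0 : 0 < u := by linarith [hu.1]
    rw [profileDeriv2_eq_rpow hε (by linarith [hu.1])]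
    rcases le_total 0 (p - 1) with h | h
    · calc c * v ^ (p - 1) ≤ (1 / 2 : ℝ) ^ (p - 1) * v ^ (p - 1) := by
            gcongr; exact min_le_right _ _
        _ = (v / 2) ^ (p - 1) := by
          rw [← Real.mul_rpow (by norm_num) hv0.le]; ring_nf
        _ ≤ _ := Real.rpow_le_rpow (by linarith) hu.1 h
    · calc c * v ^ (p - 1) ≤ 1 * v ^ (p - 1) := by gcongr; exact min_le_left _ _
        _ ≤ u ^ (p - 1) := by
          rw [one_mul]; exact Real.rpow_le_rpow_of_nonpos hu0 hu.2 h
  have i2 := fun a b => (continuous_profileDeriv2 (p := p) hε).intervalIntegrable (μ := volume) a b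
  have i1 := fun a b => (continuous_profileDeriv (p := p) hε).intervalIntegrable (μ := volume) a b
  -- `F'` is bounded below at `3v/4` by integrating `F''` over `[v/2, 3v/4]`; it is nondecreasing,
  -- so the integral of `F'` over `[3v/4, v]` is bounded below as well.
  have h1 : v / 4 * (c * v ^ (p - 1)) ≤ profileDeriv p ε (3 * v / 4) := by
    have e : profileDeriv p ε (3 * v / 4) =
        profileDeriv p ε (v / 2) + ∫ u in (v / 2)..(3 * v / 4), profileDeriv2 p ε u :=
      (intervalIntegral.integral_add_adjacent_intervals (i2 _ _) (i2 _ _)).symm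
    have : ∫ u in (v / 2)..(3 * v / 4), c * v ^ (p - 1) ≤
        ∫ u in (v / 2)..(3 * v / 4), profileDeriv2 p ε u :=
      intervalIntegral.integral_mono_on (by linarith) (by simp) (i2 _ _) fun u hu =>
        hk u ⟨hu.1, by linarith [hu.2]⟩
    rw [intervalIntegral.integral_const, smul_eq_mul] at this
    rw [e]
    have h0 := profileDeriv_nonneg (p := p) hε (v / 2)
    calc _ = (3 * v / 4 - v / 2) * (c * v ^ (p - 1)) := by ring
      _ ≤ _ := by linarith
  have e : profile p ε v =
      profile p ε (3 * v / 4) + ∫ u in (3 * v / 4)..v, profileDeriv p ε u :=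
    (intervalIntegral.integral_add_adjacent_intervals (i1 _ _) (i1 _ _)).symm
  have : ∫ u in (3 * v / 4)..v, profileDeriv p ε (3 * v / 4) ≤
      ∫ u in (3 * v / 4)..v, profileDeriv p ε u :=
    intervalIntegral.integral_mono_on (by linarith) (by simp) (i1 _ _) fun u hu =>
      monotone_profileDeriv hε hu.1
  rw [intervalIntegral.integral_const, smul_eq_mul] at this
  rw [e]
  have h0 := profile_nonneg (p := p) hε (3 * v / 4)
  have h2 : v ^ (1 + p) = v * v * v ^ (p - 1) := by
    rw [show 1 + p = 1 + 1 + (p - 1) by ring, Real.rpow_add hv0, Real.rpow_add hv0, Real.rpow_one]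
  rw [h2]
  calc _ = v / 4 * (v / 4 * (c * v ^ (p - 1))) := by ring
    _ ≤ v / 4 * profileDeriv p ε (3 * v / 4) := by gcongr
    _ ≤ _ := by linarith
end profile

/-! ### Green's identity and elementary Laplacians -/

/-- The function `φ` is of class `C²` on `U` with Laplacian `Λ`, in terms of derivatives along
lines: `D e` and `D2 e` are the first and second derivatives of `φ` in the direction `e`, and `Λ`
is the sum of the second derivatives in the directions `1` and `I`. -/
structure HasLaplacianOn (U : Set ℂ) (φ Λ : ℂ → ℝ) (D D2 : ℂ → ℂ → ℝ) : Prop where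
  hasLineDerivAt : ∀ e, ∀ z ∈ U, HasLineDerivAt ℝ φ (D e z) z e
  hasLineDerivAt2 : ∀ e, ∀ z ∈ U, HasLineDerivAt ℝ (D e) (D2 e z) z e
  continuousOn : ContinuousOn φ U
  continuousOn_deriv : ∀ e, ContinuousOn (D e) U
  continuousOn_deriv2 : ∀ e, ContinuousOn (D2 e) U
  eq_add : ∀ z ∈ U, Λ z = D2 1 z + D2 Complex.I z

theorem continuous_mul_of_tsupport_subset {U : Set ℂ} (hU : IsOpen U) {v w : ℂ → ℝ}
    (hv : ContinuousOn v U) (hw : Continuous w) (hwU : tsupport w ⊆ U) :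
    Continuous fun z => v z * w z := by
  refine continuous_iff_continuousAt.2 fun z => ?_
  by_cases hz : z ∈ tsupport w
  · exact (hv.continuousAt (hU.mem_nhds (hwU hz))).mul hw.continuousAt
  · have : (fun z => v z * w z) =ᶠ[𝓝 z] fun _ => 0 := by
      filter_upwards [notMem_tsupport_iff_eventuallyEq.1 hz] with y hy
      simp [hy]
    exact this.continuousAt

theorem integrable_mul_of_tsupport_subset {U : Set ℂ} (hU : IsOpen U) {v w : ℂ → ℝ}
    (hv : ContinuousOn v U) (hw : Continuous w) (hc : HasCompactSupport w) (hwU : tsupport w ⊆ U) :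
    Integrable fun z => v z * w z :=
  (continuous_mul_of_tsupport_subset hU hv hw hwU).integrable_of_hasCompactSupport hc.mul_left

theorem HasLineDerivAt.tsupport_subset {φ D : ℂ → ℝ} {e : ℂ}
    (h : ∀ z, HasLineDerivAt ℝ φ (D z) z e) : tsupport D ⊆ tsupport φ := by
  refine closure_minimal (fun z hz => ?_) (isClosed_tsupport φ)
  by_contra hzφ
  refine hz ?_
  have h0 : φ =ᶠ[𝓝 z] fun _ => 0 := notMem_tsupport_iff_eventuallyEq.1 hzφ
  have h1 : HasLineDerivAt ℝ (fun _ : ℂ => (0 : ℝ)) (D z) z e := (h z).congr_of_eventuallyEq h0.symm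
  exact h1.unique (hasDerivAt_const (0 : ℝ) (0 : ℝ))

/-- Green's second identity, for a compactly supported test function `φ` and a function `v` that is
`C²` near the support of `φ`. It is two integrations by parts in each of the directions `1`, `I`. -/
theorem integral_mul_laplacian {U : Set ℂ} (hU : IsOpen U) {φ Λφ v Λv : ℂ → ℝ}
    {Dφ D2φ Dv D2v : ℂ → ℂ → ℝ} (hφ : HasLaplacianOn univ φ Λφ Dφ D2φ)
    (hc : HasCompactSupport φ) (hφU : tsupport φ ⊆ U) (hv : HasLaplacianOn U v Λv Dv D2v) :
    ∫ z, v z * Λφ z = ∫ z, Λv z * φ z := by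
  have hs1 : ∀ e, tsupport (Dφ e) ⊆ tsupport φ := fun e =>
    HasLineDerivAt.tsupport_subset fun z => hφ.hasLineDerivAt e z trivial
  have hs2 : ∀ e, tsupport (D2φ e) ⊆ tsupport φ := fun e =>
    (HasLineDerivAt.tsupport_subset fun z => hφ.hasLineDerivAt2 e z trivial).trans (hs1 e)
  have hc1 : ∀ e, HasCompactSupport (Dφ e) := fun e => hc.mono' (subset_tsupport _ |>.trans (hs1 e))
  have hc2 : ∀ e, HasCompactSupport (D2φ e) := fun e =>
    hc.mono' (subset_tsupport _ |>.trans (hs2 e))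
  have k0 : Continuous φ := continuousOn_univ.1 hφ.continuousOn
  have k1 : ∀ e, Continuous (Dφ e) := fun e => continuousOn_univ.1 (hφ.continuousOn_deriv e)
  have k2 : ∀ e, Continuous (D2φ e) := fun e => continuousOn_univ.1 (hφ.continuousOn_deriv2 e)
  have i2 : ∀ e, Integrable fun z => v z * D2φ e z := fun e =>
    integrable_mul_of_tsupport_subset hU hv.continuousOn (k2 e) (hc2 e) ((hs2 e).trans hφU)
  have i0 : ∀ e, Integrable fun z => D2v e z * φ z := fun e =>
    integrable_mul_of_tsupport_subset hU (hv.continuousOn_deriv2 e) k0 hc hφU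
  have i11 : ∀ e, Integrable fun z => Dv e z * Dφ e z := fun e =>
    integrable_mul_of_tsupport_subset hU (hv.continuousOn_deriv e) (k1 e) (hc1 e)
      ((hs1 e).trans hφU)
  have i01 : ∀ e, Integrable fun z => v z * Dφ e z := fun e =>
    integrable_mul_of_tsupport_subset hU hv.continuousOn (k1 e) (hc1 e) ((hs1 e).trans hφU)
  have i10 : ∀ e, Integrable fun z => Dv e z * φ z := fun e =>
    integrable_mul_of_tsupport_subset hU (hv.continuousOn_deriv e) k0 hc hφU
  have key : ∀ e, ∫ z, v z * D2φ e z = ∫ z, D2v e z * φ z := fun e => by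
    have h1 : ∫ z, v z * D2φ e z = - ∫ z, Dv e z * Dφ e z :=
      integral_bilinear_hasLineDerivAt_right_eq_neg_left_of_integrable (v := e)
        (B := ContinuousLinearMap.mul ℝ ℝ) (i11 e) (i2 e) (i01 e)
        (fun z hz => hv.hasLineDerivAt e z (hφU (hs1 e hz)))
        (fun z _ => hφ.hasLineDerivAt2 e z trivial)
    have h2 : ∫ z, Dv e z * Dφ e z = - ∫ z, D2v e z * φ z :=
      integral_bilinear_hasLineDerivAt_right_eq_neg_left_of_integrable (v := e)
        (B := ContinuousLinearMap.mul ℝ ℝ) (i0 e) (i11 e) (i10 e)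
        (fun z hz => hv.hasLineDerivAt2 e z (hφU hz))
        (fun z _ => hφ.hasLineDerivAt e z trivial)
    rw [h1, h2, neg_neg]
  calc ∫ z, v z * Λφ z = ∫ z, (v z * D2φ 1 z + v z * D2φ Complex.I z) := by
        congr 1; ext z; rw [hφ.eq_add z trivial]; ring
    _ = ∫ z, (D2v 1 z * φ z + D2v Complex.I z * φ z) := by
        rw [integral_add (i2 _) (i2 _), integral_add (i0 _) (i0 _), key, key]
    _ = ∫ z, Λv z * φ z := by
        congr 1; ext z
        by_cases hz : z ∈ tsupport φ
        · rw [hv.eq_add z (hφU hz)]; ring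
        · simp [image_eq_zero_of_notMem_tsupport hz]

theorem hasDerivAt_line (z e : ℂ) (t : ℝ) : HasDerivAt (fun t : ℝ => z + t • e) e t := by
  simpa using ((hasDerivAt_id t).smul_const e).const_add z

theorem HasDerivAt.hasDerivAt_line {h : ℂ → ℂ} {h' z : ℂ} (hh : HasDerivAt h h' z) (e : ℂ) :
    HasDerivAt (fun t : ℝ => h (z + t • e)) (e * h') 0 := by
  have := hh.scomp_of_eq (0 : ℝ) (_root_.hasDerivAt_line z e 0) (by simp)
  simpa [Function.comp_def] using this

theorem HasDerivAt.hasLineDerivAt_re_mul {h : ℂ → ℂ} {h' z : ℂ} (hh : HasDerivAt h h' z) (e : ℂ) :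
    HasLineDerivAt ℝ (fun z => (e * h z).re) (e * (e * h')).re z e :=
  (Complex.reCLM.hasFDerivAt.comp_hasDerivAt (0 : ℝ) ((hh.hasDerivAt_line e).const_mul e))

theorem HasDerivAt.hasLineDerivAt_log_norm {h : ℂ → ℂ} {h' z : ℂ} (hh : HasDerivAt h h' z)
    (hz : h z ≠ 0) (e : ℂ) :
    HasLineDerivAt ℝ (fun z => Real.log ‖h z‖) (e * (h' / h z)).re z e := by
  have h1 : HasDerivAt (fun t : ℝ => ‖h (z + t • e)‖ ^ 2) _ 0 := (hh.hasDerivAt_line e).norm_sq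
  have h2 := (h1.log (by simpa using hz)).div_const 2
  refine HasDerivAt.congr_deriv (h2.congr_of_eventuallyEq (.of_forall fun t => ?_)) ?_
  · simp [Real.log_pow]
  · have hn : ‖h z‖ ≠ 0 := norm_ne_zero_iff.2 hz
    simp only [zero_smul, add_zero]
    rw [← Complex.normSq_eq_norm_sq, Complex.inner]
    simp only [Complex.mul_re, Complex.div_re, Complex.div_im, Complex.conj_re, Complex.conj_im,
      Complex.mul_im]
    have : Complex.normSq (h z) ≠ 0 := by simpa using hz
    field_simp
    ring

/-- The logarithm of the modulus of a nonvanishing holomorphic function is harmonic. -/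
theorem hasLaplacianOn_log_norm {U : Set ℂ} (hU : IsOpen U) {h : ℂ → ℂ}
    (hh : DifferentiableOn ℂ h U)
    (h0 : ∀ z ∈ U, h z ≠ 0) :
    HasLaplacianOn U (fun z => Real.log ‖h z‖) 0 (fun e z => (e * logDeriv h z).re)
      (fun e z => (e * (e * deriv (logDeriv h) z)).re) := by
  have hd : DifferentiableOn ℂ (logDeriv h) U := (hh.deriv hU).div hh h0
  constructor
  · exact fun e z hz => ((hh.differentiableAt (hU.mem_nhds hz)).hasDerivAt).hasLineDerivAt_log_norm
      (h0 z hz) e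
  · exact fun e z hz => ((hd.differentiableAt (hU.mem_nhds hz)).hasDerivAt).hasLineDerivAt_re_mul e
  · exact hh.continuousOn.norm.log fun z hz => norm_ne_zero_iff.2 (h0 z hz)
  · exact fun e => Complex.continuous_re.comp_continuousOn (hd.continuousOn.const_mul e)
  · exact fun e => Complex.continuous_re.comp_continuousOn
      (((hd.deriv hU).continuousOn.const_mul e).const_mul e)
  · intro z _
    simp [← mul_assoc]

/-- The function `log (|z - a|² + κ) / 2`, which regularises `log |z - a|`, has Laplacian
`2 κ / (|z - a|² + κ)²`. -/
theorem hasLaplacianOn_log_add (a : ℂ) {κ : ℝ} (hκ : 0 < κ) :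
    HasLaplacianOn univ (fun z => Real.log (‖z - a‖ ^ 2 + κ) / 2)
      (fun z => 2 * κ / (‖z - a‖ ^ 2 + κ) ^ 2)
      (fun e z => inner ℝ (z - a) e / (‖z - a‖ ^ 2 + κ))
      (fun e z => ‖e‖ ^ 2 / (‖z - a‖ ^ 2 + κ) -
        2 * (inner ℝ (z - a) e) ^ 2 / (‖z - a‖ ^ 2 + κ) ^ 2) := by
  have hpos : ∀ z : ℂ, 0 < ‖z - a‖ ^ 2 + κ := fun z => by positivity
  have hl : ∀ z e : ℂ, HasDerivAt (fun t : ℝ => z + t • e - a) e 0 := fun z e =>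
    (hasDerivAt_line z e 0).sub_const a
  have hn : ∀ z e : ℂ, HasDerivAt (fun t : ℝ => ‖z + t • e - a‖ ^ 2 + κ)
      (2 * inner ℝ (z - a) e) 0 := fun z e => by
    simpa using ((hl z e).norm_sq).add_const κ
  constructor
  · intro e z _
    refine HasDerivAt.congr_deriv (((hn z e).log (by simpa using (hpos z).ne')).div_const 2) ?_
    have := (hpos z).ne'
    simp only [zero_smul, add_zero]
    field_simp
  · intro e z _
    have hi : HasDerivAt (fun t : ℝ => inner ℝ (z + t • e - a) e) (‖e‖ ^ 2) 0 := by
      simpa using (hl z e).inner ℝ (hasDerivAt_const (0 : ℝ) e)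
    refine HasDerivAt.congr_deriv (hi.div (hn z e) (by simpa using (hpos z).ne')) ?_
    have := (hpos z).ne'
    simp only [zero_smul, add_zero]
    field_simp
  · exact (Continuous.log (by fun_prop) fun z => (hpos z).ne').div_const 2 |>.continuousOn
  · exact fun e => (Continuous.div (by fun_prop) (by fun_prop) fun z => (hpos z).ne').continuousOn
  · intro e
    refine Continuous.continuousOn (Continuous.sub ?_ ?_)
    · exact Continuous.div (by fun_prop) (by fun_prop) fun z => (hpos z).ne'
    · exact Continuous.div (by fun_prop) (by fun_prop) fun z => (pow_pos (hpos z) 2).ne'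
  · intro z _
    have := (hpos z).ne'
    simp only [Complex.inner, norm_one, Complex.norm_I]
    rw [← Complex.normSq_eq_norm_sq, Complex.normSq_apply] at this ⊢
    simp
    field_simp
    ring

/-! ### The fundamental solution of the Laplacian in the plane -/

theorem integral_Ioi_mul_one_div_one_add_sq_sq :
    ∫ r in Ioi (0 : ℝ), r * (1 / (1 + r ^ 2) ^ 2) = 1 / 2 := by
  have h : ∀ r ∈ Ici (0 : ℝ), HasDerivAt (fun r : ℝ => -(1 + r ^ 2)⁻¹ / 2)
      (r * (1 / (1 + r ^ 2) ^ 2)) r := fun r _ => by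
    have hp : (1 + r ^ 2) ≠ 0 := by positivity
    have := (((((hasDerivAt_id r).pow 2).const_add 1).inv hp).neg).div_const 2
    refine this.congr_deriv ?_
    simp
    field_simp
  have ht : Tendsto (fun r : ℝ => -(1 + r ^ 2)⁻¹ / 2) atTop (𝓝 (-0 / 2)) := by
    refine Tendsto.div_const (Tendsto.neg (Tendsto.inv_tendsto_atTop ?_)) 2
    exact tendsto_atTop_add_const_left _ _ (tendsto_pow_atTop two_ne_zero)
  rw [integral_Ioi_of_hasDerivAt_of_nonneg' h (fun r hr => ?_) ht]
  · norm_num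
  · have : (0 : ℝ) < r := hr
    positivity

theorem integral_pi_inv_mul_one_div_one_add_norm_sq_sq :
    ∫ z : ℂ, Real.pi⁻¹ * (1 / (1 + ‖z‖ ^ 2) ^ 2) = 1 := by
  rw [integral_const_mul, ← Complex.integral_comp_polarCoord_symm, polarCoord_target,
    Measure.volume_eq_prod]
  have : ∀ p : ℝ × ℝ, p.1 • (1 / (1 + ‖Complex.polarCoord.symm p‖ ^ 2) ^ 2) =
      (p.1 * (1 / (1 + p.1 ^ 2) ^ 2)) * 1 := fun p => by
    rw [Complex.norm_polarCoord_symm, sq_abs, smul_eq_mul, mul_one]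
  simp_rw [this]
  rw [setIntegral_prod_mul (fun r : ℝ => r * (1 / (1 + r ^ 2) ^ 2)) (fun _ => (1 : ℝ)),
    integral_Ioi_mul_one_div_one_add_sq_sq]
  simp
  rw [max_eq_left (by positivity)]
  field_simp
  ring

/-- The Laplacians of the regularised logarithms `log (|z - a|² + c⁻²) / 2` are `2π` times an
approximate identity at `a`, as `c → ∞`. -/
theorem tendsto_integral_laplacian_log_add (a : ℂ) {φ : ℂ → ℝ} (hφ : Continuous φ)
    (hc : HasCompactSupport φ) :
    Tendsto (fun c : ℝ => ∫ z, 2 * (c ^ 2)⁻¹ / (‖z - a‖ ^ 2 + (c ^ 2)⁻¹) ^ 2 * φ z) atTop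
      (𝓝 (2 * Real.pi * φ a)) := by
  have key := tendsto_integral_comp_smul_smul_of_integrable' (μ := (volume : Measure ℂ))
    (φ := fun z : ℂ => Real.pi⁻¹ * (1 / (1 + ‖z‖ ^ 2) ^ 2))
    (fun z => by positivity) integral_pi_inv_mul_one_div_one_add_norm_sq_sq ?_ (g := φ) (x₀ := a)
    (hφ.integrable_of_hasCompactSupport hc) hφ.continuousAt
  · refine (key.const_mul (2 * Real.pi)).congr' ?_
    filter_upwards [eventually_gt_atTop 0] with c hc0
    rw [← integral_const_mul]
    congr 1; ext z
    have e : ‖c • (a - z)‖ ^ 2 = c ^ 2 * ‖z - a‖ ^ 2 := by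
      rw [norm_smul, mul_pow, norm_sub_rev]; simp
    rw [e, Complex.finrank_real_complex, smul_eq_mul]
    have h1 : 1 + c ^ 2 * ‖z - a‖ ^ 2 ≠ 0 := by positivity
    have h2 : ‖z - a‖ ^ 2 + (c ^ 2)⁻¹ = (1 + c ^ 2 * ‖z - a‖ ^ 2) / c ^ 2 := by
      field_simp; ring
    rw [h2]
    have := Real.pi_pos.ne'
    field_simp
  · rw [Complex.finrank_real_complex]
    have h1 : Tendsto (fun x : ℂ => Real.pi⁻¹ * (‖x‖ ^ 2)⁻¹) (Bornology.cobounded ℂ)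
        (𝓝 (Real.pi⁻¹ * 0)) := by
      refine Tendsto.const_mul _ (Tendsto.inv_tendsto_atTop ?_)
      exact (tendsto_pow_atTop two_ne_zero).comp tendsto_norm_cobounded_atTop
    rw [mul_zero] at h1
    refine squeeze_zero' (.of_forall fun z => by positivity) ?_ h1
    filter_upwards [(tendsto_norm_cobounded_atTop (E := ℂ)).eventually_gt_atTop 0] with z hz
    have h3 : ‖z‖ ^ 2 * (1 / (1 + ‖z‖ ^ 2) ^ 2) ≤ (‖z‖ ^ 2)⁻¹ := by
      rw [mul_one_div, div_le_iff₀ (by positivity), inv_mul_eq_div, le_div_iff₀ (by positivity)]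
      nlinarith [sq_nonneg ‖z‖]
    calc _ = Real.pi⁻¹ * (‖z‖ ^ 2 * (1 / (1 + ‖z‖ ^ 2) ^ 2)) := by ring
      _ ≤ _ := by gcongr

/-- In polar coordinates the integrand `r |log r|` is bounded on bounded sets. -/
theorem integrableOn_log_norm_ball (R : ℝ) :
    IntegrableOn (fun z : ℂ => Real.log ‖z‖) (Metric.ball 0 R) := by
  rcases le_or_gt R 0 with hR | hR
  · simp [Metric.ball_eq_empty.2 hR]
  refine ⟨(Real.measurable_log.comp measurable_norm).aestronglyMeasurable, ?_⟩
  rw [HasFiniteIntegral, ← lintegral_indicator measurableSet_ball,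
    ← Complex.lintegral_comp_polarCoord_symm]
  have hle : ∀ p ∈ polarCoord.target, ENNReal.ofReal p.1 •
      (Metric.ball (0 : ℂ) R).indicator (fun z => ‖Real.log ‖z‖‖ₑ) (Complex.polarCoord.symm p) ≤
      (Ioo (0 : ℝ) R ×ˢ Ioo (-Real.pi) Real.pi).indicator
        (fun _ => ENNReal.ofReal (1 + R ^ 2)) p := by
    rintro ⟨r, θ⟩ ⟨hr, hθ⟩
    have hr0 : (0 : ℝ) < r := hr
    by_cases hrR : r < R
    · rw [indicator_of_mem (show (r, θ) ∈ Ioo (0 : ℝ) R ×ˢ Ioo (-Real.pi) Real.pi from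
        ⟨⟨hr0, hrR⟩, hθ⟩)]
      refine (mul_le_mul_right (indicator_le_self _ _ _) _).trans ?_
      rw [Complex.norm_polarCoord_symm, abs_of_pos hr0, Real.enorm_eq_ofReal_abs,
        ← ENNReal.ofReal_mul hr0.le]
      refine ENNReal.ofReal_le_ofReal ?_
      rcases le_total r 1 with h1 | h1
      · have := Real.abs_log_mul_self_lt r hr0 h1
        rw [abs_mul, abs_of_pos hr0, mul_comm] at this
        nlinarith
      · rw [abs_of_nonneg (Real.log_nonneg h1)]
        have := Real.log_le_sub_one_of_pos hr0
        nlinarith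
    · rw [indicator_of_notMem]
      · simp
      · simpa [abs_of_pos hr0, -Complex.polarCoord_symm_apply, Complex.norm_polarCoord_symm]
          using not_lt.1 hrR
  refine (setLIntegral_mono' polarCoord.open_target.measurableSet hle).trans_lt ?_
  refine (setLIntegral_le_lintegral _ _).trans_lt ?_
  rw [lintegral_indicator_const (measurableSet_Ioo.prod measurableSet_Ioo), Measure.volume_eq_prod,
    Measure.prod_prod]
  simp [ENNReal.mul_lt_top]

theorem locallyIntegrable_log_norm_sub (a : ℂ) :
    LocallyIntegrable fun z : ℂ => Real.log ‖z - a‖ := by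
  intro z
  refine ⟨Metric.ball a (dist z a + 1), Metric.isOpen_ball.mem_nhds (by simp), ?_⟩
  have h := integrableOn_log_norm_ball (dist z a + 1)
  have hp : MeasurePreserving (fun z : ℂ => z - a) := measurePreserving_sub_right volume a
  have := (hp.integrableOn_comp_preimage (measurableEmbedding_subRight a)).2 h
  simpa [Function.comp_def, preimage, Metric.ball, dist_eq_norm] using this

/-- `log |z - a| / (2π)` is a fundamental solution of the Laplacian with pole at `a`. -/
theorem integral_log_norm_sub_mul_laplacian (a : ℂ) {φ Λ : ℂ → ℝ} {D D2 : ℂ → ℂ → ℝ}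
    (hφ : HasLaplacianOn univ φ Λ D D2) (hc : HasCompactSupport φ) (hΛ : Continuous Λ)
    (hcΛ : HasCompactSupport Λ) :
    ∫ z, Real.log ‖z - a‖ * Λ z = 2 * Real.pi * φ a := by
  refine tendsto_nhds_unique ?_ (tendsto_integral_laplacian_log_add a
    (continuousOn_univ.1 hφ.continuousOn) hc)
  have hG : ∀ c : ℝ, 0 < c → ∫ z, 2 * (c ^ 2)⁻¹ / (‖z - a‖ ^ 2 + (c ^ 2)⁻¹) ^ 2 * φ z =
      ∫ z, Real.log (‖z - a‖ ^ 2 + (c ^ 2)⁻¹) / 2 * Λ z := fun c hc0 =>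
    (integral_mul_laplacian isOpen_univ hφ hc (subset_univ _)
      (hasLaplacianOn_log_add a (κ := (c ^ 2)⁻¹) (by positivity))).symm
  refine Tendsto.congr' (f₁ := fun c : ℝ => ∫ z, Real.log (‖z - a‖ ^ 2 + (c ^ 2)⁻¹) / 2 * Λ z) ?_ ?_
  · filter_upwards [eventually_gt_atTop 0] with c hc0 using (hG c hc0).symm
  -- For `c ≥ 1` the regularised logarithm lies between `log |z - a|` and `|z - a|²`.
  refine tendsto_integral_filter_of_dominated_convergence
    (fun z => |Real.log ‖z - a‖ * Λ z| + ‖z - a‖ ^ 2 * |Λ z| + |Λ z|) ?_ ?_ ?_ ?_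
  · filter_upwards [eventually_gt_atTop 0] with c hc0
    refine Continuous.aestronglyMeasurable (Continuous.mul ?_ hΛ)
    exact (Continuous.log (by fun_prop) fun z => by positivity).div_const 2
  · filter_upwards [eventually_ge_atTop 1] with c hc1
    filter_upwards [compl_mem_ae_iff.2 (measure_singleton a)] with z hz
    have hz0 : 0 < ‖z - a‖ := norm_pos_iff.2 (sub_ne_zero.2 hz)
    rw [Real.norm_eq_abs, abs_mul, abs_mul]
    have : |Real.log (‖z - a‖ ^ 2 + (c ^ 2)⁻¹) / 2| ≤ |Real.log ‖z - a‖| + ‖z - a‖ ^ 2 + 1 := by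
      have hc2 : 0 < (c ^ 2)⁻¹ := by positivity
      have hc3 : (c ^ 2)⁻¹ ≤ 1 := inv_le_one_of_one_le₀ (by nlinarith)
      have l1 : 2 * Real.log ‖z - a‖ ≤ Real.log (‖z - a‖ ^ 2 + (c ^ 2)⁻¹) := by
        have := Real.log_le_log (by positivity : 0 < ‖z - a‖ ^ 2)
          (by linarith : ‖z - a‖ ^ 2 ≤ ‖z - a‖ ^ 2 + (c ^ 2)⁻¹)
        rwa [Real.log_pow] at this
      have l2 := Real.log_le_sub_one_of_pos (by positivity : 0 < ‖z - a‖ ^ 2 + (c ^ 2)⁻¹)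
      rw [abs_le]
      constructor
      · linarith [neg_abs_le (Real.log ‖z - a‖), sq_nonneg ‖z - a‖]
      · linarith [abs_nonneg (Real.log ‖z - a‖), sq_nonneg ‖z - a‖]
    nlinarith [abs_nonneg (Λ z), mul_le_mul_of_nonneg_right this (abs_nonneg (Λ z))]
  · refine Integrable.add (Integrable.add ?_ ?_) ?_
    · have := (locallyIntegrable_log_norm_sub a).integrable_smul_right_of_hasCompactSupport hΛ hcΛ
      simpa [smul_eq_mul, mul_comm] using this.abs
    · exact (Continuous.mul (by fun_prop) hΛ.abs).integrable_of_hasCompactSupport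
        (hcΛ.comp_left abs_zero).mul_left
    · exact hΛ.abs.integrable_of_hasCompactSupport (hcΛ.comp_left abs_zero)
  · filter_upwards [compl_mem_ae_iff.2 (measure_singleton a)] with z hz
    have hz0 : 0 < ‖z - a‖ := norm_pos_iff.2 (sub_ne_zero.2 hz)
    refine Tendsto.mul_const _ ?_
    have h0 : Tendsto (fun c : ℝ => ‖z - a‖ ^ 2 + (c ^ 2)⁻¹) atTop (𝓝 (‖z - a‖ ^ 2 + 0)) :=
      (Tendsto.inv_tendsto_atTop (tendsto_pow_atTop two_ne_zero)).const_add _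
    have := (h0.log (by positivity)).div_const 2
    rwa [add_zero, Real.log_pow, Nat.cast_ofNat, mul_div_cancel_left₀ _ two_ne_zero] at this

/-! ### The Riesz and Jensen formulas for an analytic function -/

theorem AnalyticOnNhd.divisor_eq_analyticOrderNatAt {g : ℂ → ℂ} {U : Set ℂ}
    (hg : AnalyticOnNhd ℂ g U) {z : ℂ} (hz : z ∈ U) :
    MeromorphicOn.divisor g U z = (analyticOrderNatAt g z : ℤ) := by
  rw [MeromorphicOn.AnalyticOnNhd.divisor_apply hg hz, analyticOrderNatAt]
  cases h : analyticOrderAt g z with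
  | top => simp
  | coe n => simp

/-- On the closed disc, `log |g|` is almost everywhere the sum of the logarithms
`m_a log |z - a|` over a finite set `T` containing all zeros, and of `log |h|` with `h` analytic
and zero-free. -/
theorem AnalyticOnNhd.exists_log_norm_eq {g : ℂ → ℂ}
    (hg : AnalyticOnNhd ℂ g (Metric.closedBall 0 1)) (h0 : g 0 ≠ 0) :
    ∃ (T : Finset ℂ) (h : ℂ → ℂ), AnalyticOnNhd ℂ h (Metric.closedBall 0 1) ∧
      (∀ z ∈ Metric.closedBall (0 : ℂ) 1, h z ≠ 0) ∧
      (∀ z ∈ Metric.closedBall (0 : ℂ) 1, analyticOrderNatAt g z ≠ 0 → z ∈ T) ∧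
      ∀ᵐ z ∂volume.restrict (Metric.closedBall (0 : ℂ) 1), Real.log ‖g z‖ =
        ∑ a ∈ T, (analyticOrderNatAt g a : ℝ) * Real.log ‖z - a‖ + Real.log ‖h z‖ := by
  set U := Metric.closedBall (0 : ℂ) 1 with hU
  have hUc : IsConnected U :=
    ⟨⟨0, by simp [hU]⟩, (convex_closedBall (0 : ℂ) 1).isPreconnected⟩
  have h0U : (0 : ℂ) ∈ U := by simp [hU]
  have hord : ∀ u : U, meromorphicOrderAt g u ≠ ⊤ :=
    (hg.meromorphicOn.exists_meromorphicOrderAt_ne_top_iff_forall hUc).1 ⟨⟨0, h0U⟩, by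
      rw [(hg 0 h0U).meromorphicOrderAt_eq, (hg 0 h0U).analyticOrderAt_eq_zero.2 h0]; simp⟩
  have hfin : (MeromorphicOn.divisor g U).support.Finite :=
    (MeromorphicOn.divisor g U).finiteSupport (isCompact_closedBall _ _)
  obtain ⟨h, hh, hh0, heq⟩ := hg.meromorphicOn.extract_zeros_poles hord hfin
  have hlog := MeromorphicOn.extract_zeros_poles_log hh0 heq
  have hsub : ∀ z ∈ hfin.toFinset, z ∈ U := fun z hz =>
    (MeromorphicOn.divisor g U).supportWithinDomain (by simpa using hz)
  refine ⟨hfin.toFinset, h, hh, fun z hz => hh0 ⟨z, hz⟩, fun z hz hne => ?_, ?_⟩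
  · simpa [hg.divisor_eq_analyticOrderNatAt hz] using hne
  · filter_upwards [ae_restrict_le_codiscreteWithin Metric.isClosed_closedBall.measurableSet hlog]
      with z hz
    rw [hz, Pi.add_apply, finsum_eq_sum_of_support_subset (s := hfin.toFinset), Finset.sum_apply]
    · congr 1
      refine Finset.sum_congr rfl fun a ha => ?_
      rw [hg.divisor_eq_analyticOrderNatAt (hsub a ha)]
      simp
    · intro a
      contrapose
      intro ha
      have : (MeromorphicOn.divisor g U) a = 0 := by simpa using ha
      simp [this]
      rfl

theorem AnalyticOnNhd.integrableOn_log_norm {g : ℂ → ℂ}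
    (hg : AnalyticOnNhd ℂ g (Metric.closedBall 0 1)) (h0 : g 0 ≠ 0) :
    IntegrableOn (fun z => Real.log ‖g z‖) (Metric.closedBall 0 1) := by
  obtain ⟨T, h, hh, hh0, -, heq⟩ := hg.exists_log_norm_eq h0
  refine Integrable.congr (Integrable.add (integrable_finsetSum _ fun a _ => ?_) ?_)
    (heq.mono fun z hz => hz.symm)
  · exact ((locallyIntegrable_log_norm_sub a).integrableOn_isCompact
      (isCompact_closedBall _ _)).const_mul _
  · exact ContinuousOn.integrableOn_compact (isCompact_closedBall _ _)
      (hh.continuousOn.norm.log fun z hz => norm_ne_zero_iff.2 (hh0 z hz))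

/-- The Riesz formula for the subharmonic function `log |g|`, whose distributional Laplacian is `2π`
times the sum of the point masses at the zeros. It is stated as an inequality for a nonnegative test
function, so that the sum may run over any finite set `S`. -/
theorem AnalyticOnNhd.sum_zeros_le_integral {g : ℂ → ℂ}
    (hg : AnalyticOnNhd ℂ g (Metric.closedBall 0 1)) (h0 : g 0 ≠ 0)
    {φ Λ : ℂ → ℝ} {D D2 : ℂ → ℂ → ℝ} (hφ : HasLaplacianOn univ φ Λ D D2)
    (hc : HasCompactSupport φ) (hU : tsupport φ ⊆ Metric.ball 0 1) (hΛ : Continuous Λ)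
    (hΛU : tsupport Λ ⊆ Metric.ball 0 1) (hφ0 : ∀ z, 0 ≤ φ z) (S : Finset ℂ)
    (hS : ∀ a ∈ S, a ∈ Metric.ball (0 : ℂ) 1) :
    2 * Real.pi * ∑ a ∈ S, (analyticOrderNatAt g a : ℝ) * φ a ≤
      ∫ z in Metric.ball (0 : ℂ) 1, Real.log ‖g z‖ * Λ z := by
  obtain ⟨T, h, hh, hh0, hT, heq⟩ := hg.exists_log_norm_eq h0
  have hcΛ : HasCompactSupport Λ :=
    (isCompact_closedBall (0 : ℂ) 1).of_isClosed_subset (isClosed_tsupport _)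
      (hΛU.trans Metric.ball_subset_closedBall)
  have hS1 : ∑ a ∈ S, (analyticOrderNatAt g a : ℝ) * φ a ≤
      ∑ a ∈ T, (analyticOrderNatAt g a : ℝ) * φ a := by
    rw [← Finset.sum_filter_of_ne (p := fun a => analyticOrderNatAt g a ≠ 0)
      fun a _ hne h => hne (by simp [h])]
    refine Finset.sum_le_sum_of_subset_of_nonneg (fun a ha => ?_) fun a _ _ =>
      mul_nonneg (Nat.cast_nonneg _) (hφ0 a)
    rw [Finset.mem_filter] at ha
    exact hT a (Metric.ball_subset_closedBall (hS a ha.1)) ha.2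
  have hlh : HasLaplacianOn (Metric.ball 0 1) (fun z => Real.log ‖h z‖) 0 _ _ :=
    hasLaplacianOn_log_norm Metric.isOpen_ball
      (hh.differentiableOn.mono Metric.ball_subset_closedBall)
      fun z hz => hh0 z (Metric.ball_subset_closedBall hz)
  have hih : Integrable fun z => Real.log ‖h z‖ * Λ z :=
    integrable_mul_of_tsupport_subset Metric.isOpen_ball hlh.continuousOn hΛ hcΛ hΛU
  have hi : ∀ a, Integrable fun z => Real.log ‖z - a‖ * Λ z := fun a => by
    simpa [smul_eq_mul, mul_comm] using
      (locallyIntegrable_log_norm_sub a).integrable_smul_right_of_hasCompactSupport hΛ hcΛ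
  have hint : ∫ z in Metric.ball (0 : ℂ) 1, Real.log ‖g z‖ * Λ z =
      2 * Real.pi * ∑ a ∈ T, (analyticOrderNatAt g a : ℝ) * φ a := by
    calc ∫ z in Metric.ball (0 : ℂ) 1, Real.log ‖g z‖ * Λ z
        = ∫ z in Metric.ball (0 : ℂ) 1, (∑ a ∈ T, (analyticOrderNatAt g a : ℝ) *
            (Real.log ‖z - a‖ * Λ z) + Real.log ‖h z‖ * Λ z) := by
          refine integral_congr_ae ?_
          filter_upwards [ae_restrict_of_ae_restrict_of_subset Metric.ball_subset_closedBall heq]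
            with z hz
          rw [hz, add_mul, Finset.sum_mul]
          simp only [mul_assoc]
      _ = ∫ z, (∑ a ∈ T, (analyticOrderNatAt g a : ℝ) *
            (Real.log ‖z - a‖ * Λ z) + Real.log ‖h z‖ * Λ z) := by
          refine setIntegral_eq_integral_of_forall_compl_eq_zero fun z hz => ?_
          simp [image_eq_zero_of_notMem_tsupport fun h => hz (hΛU h)]
      _ = ∑ a ∈ T, (analyticOrderNatAt g a : ℝ) * (2 * Real.pi * φ a) + 0 := by
          rw [integral_add (integrable_finsetSum _ fun a _ => (hi a).const_mul _) hih,
            integral_finsetSum _ fun a _ => (hi a).const_mul _]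
          congr 1
          · refine Finset.sum_congr rfl fun a _ => ?_
            rw [integral_const_mul, integral_log_norm_sub_mul_laplacian a hφ hc hΛ hcΛ]
          · rw [integral_mul_laplacian Metric.isOpen_ball hφ hc hU hlh]
            simp
      _ = _ := by
          rw [add_zero, Finset.mul_sum]
          exact Finset.sum_congr rfl fun a _ => by ring
  rw [hint]
  gcongr

/-- By Jensen's formula the average is a sum of nonnegative terms `m_u log (r / |u|)`. -/
theorem AnalyticOnNhd.circleAverage_log_norm_nonneg {g : ℂ → ℂ}
    (hg : AnalyticOnNhd ℂ g (Metric.closedBall 0 1)) (h0 : ‖g 0‖ = 1) {r : ℝ} (hr : 0 < r)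
    (hr1 : r ≤ 1) : 0 ≤ Real.circleAverage (fun z => Real.log ‖g z‖) 0 r := by
  have hsub : Metric.closedBall (0 : ℂ) |r| ⊆ Metric.closedBall 0 1 := by
    rw [abs_of_pos hr]; exact Metric.closedBall_subset_closedBall hr1
  rw [(hg.mono hsub).circleAverage_log_norm hr.ne' (by rw [← norm_ne_zero_iff, h0]; simp), h0,
    Real.log_one, add_zero]
  refine finsum_nonneg fun u => ?_
  have hD : 0 ≤ MeromorphicOn.divisor g (Metric.closedBall 0 |r|) u :=
    MeromorphicOn.AnalyticOnNhd.divisor_nonneg (hg.mono hsub) u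
  by_cases hu : u ∈ Metric.closedBall (0 : ℂ) |r|
  · refine mul_nonneg (mod_cast hD) ?_
    rw [mem_closedBall_zero_iff, abs_of_pos hr] at hu
    rw [zero_sub, norm_neg]
    rcases eq_or_ne u 0 with rfl | hu0
    · simp
    · refine Real.log_nonneg ?_
      rw [← div_eq_mul_inv, one_le_div (norm_pos_iff.2 hu0)]
      exact hu
  · simp [hu]

/-- Integrated form of the nonnegativity of the circle averages of `log |g|`. -/
theorem AnalyticOnNhd.setIntegral_log_norm_nonneg {g : ℂ → ℂ}
    (hg : AnalyticOnNhd ℂ g (Metric.closedBall 0 1)) (h0 : ‖g 0‖ = 1) {ρ : ℝ} (hρ : ρ ≤ 1) :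
    0 ≤ ∫ z in Metric.ball (0 : ℂ) ρ, Real.log ‖g z‖ := by
  rw [← integral_indicator measurableSet_ball, ← Complex.integral_comp_polarCoord_symm,
    polarCoord_target]
  set F : ℝ × ℝ → ℝ := fun p => p.1 • (Metric.ball (0 : ℂ) ρ).indicator (fun z => Real.log ‖g z‖)
    (Complex.polarCoord.symm p) with hF
  -- Without integrability the integral is zero by convention, and there is nothing to prove.
  by_cases hi : IntegrableOn F (Ioi 0 ×ˢ Ioo (-Real.pi) Real.pi)
  swap
  · rw [integral_undef hi]
  rw [Measure.volume_eq_prod] at hi ⊢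
  rw [setIntegral_prod _ hi]
  refine setIntegral_nonneg measurableSet_Ioi fun r hr => ?_
  have hr0 : (0 : ℝ) < r := hr
  by_cases hrρ : r < ρ
  · have e : ∀ θ : ℝ, F (r, θ) = r * Real.log ‖g (circleMap 0 r θ)‖ := fun θ => by
      have hc : Complex.polarCoord.symm (r, θ) = circleMap 0 r θ := by
        rw [Complex.polarCoord_symm_apply, circleMap, Complex.exp_mul_I]; simp
      rw [hF]
      simp only [hc, smul_eq_mul]
      rw [indicator_of_mem]
      simpa [abs_of_pos hr0] using hrρ
    simp_rw [e]
    rw [integral_const_mul]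
    refine mul_nonneg hr0.le ?_
    rw [← integral_Ioc_eq_integral_Ioo,
      ← intervalIntegral.integral_of_le (by linarith [Real.pi_pos])]
    have hper : Function.Periodic (fun θ => Real.log ‖g (circleMap 0 r θ)‖) (2 * Real.pi) :=
      fun θ => by simp [(periodic_circleMap 0 r) θ]
    have := hper.intervalIntegral_add_eq (-Real.pi) 0
    rw [show -Real.pi + 2 * Real.pi = Real.pi by ring, zero_add] at this
    rw [this]
    have hJ := hg.circleAverage_log_norm_nonneg h0 hr0 (hrρ.le.trans hρ)
    rw [Real.circleAverage_def, smul_eq_mul] at hJ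
    exact nonneg_of_mul_nonneg_right hJ (by positivity)
  · refine le_of_eq (Eq.symm ?_)
    refine (integral_congr_ae (.of_forall fun θ => ?_)).trans (integral_zero _ _)
    simp only [hF]
    rw [indicator_of_notMem]
    · simp
    · rw [mem_ball_zero_iff, Complex.norm_polarCoord_symm, abs_of_pos hr0]; exact hrρ

/-! ### The test function and its Laplacian -/

theorem tsupport_subset_ball_of_eq_zero {ε : ℝ} (hε : 0 < ε) {f : ℂ → ℝ}
    (hf : ∀ z, 1 - ‖z‖ ^ 2 ≤ ε → f z = 0) : tsupport f ⊆ Metric.ball 0 1 := by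
  have h1 : tsupport f ⊆ {z : ℂ | ‖z‖ ^ 2 ≤ 1 - ε} := by
    refine closure_minimal (fun z hz => ?_) (isClosed_le (by fun_prop) (by fun_prop))
    by_contra h
    exact hz (hf z (by rw [mem_ofPred_eq, not_le] at h; linarith))
  intro z hz
  have h2 : ‖z‖ ^ 2 ≤ 1 - ε := h1 hz
  rw [mem_ball_zero_iff]
  nlinarith [norm_nonneg z]

theorem hasCompactSupport_of_tsupport_subset_ball {f : ℂ → ℝ}
    (hf : tsupport f ⊆ Metric.ball 0 1) : HasCompactSupport f :=
  (isCompact_closedBall (0 : ℂ) 1).of_isClosed_subset (isClosed_tsupport _)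
    (hf.trans Metric.ball_subset_closedBall)

theorem eventually_le_of_notMem_ball {ε : ℝ} (hε : 0 < ε) {z : ℂ}
    (hz : z ∉ Metric.ball (0 : ℂ) 1) : ∀ᶠ w in 𝓝 z, 1 - ‖w‖ ^ 2 ≤ ε := by
  have h1 : 1 ≤ ‖z‖ := by simpa using hz
  have h2 : 1 - ‖z‖ ^ 2 < ε := by nlinarith
  have hc : ContinuousAt (fun w : ℂ => 1 - ‖w‖ ^ 2) z := by fun_prop
  exact (hc.eventually (gt_mem_nhds h2)).mono fun w hw => le_of_lt hw

/-- A function that is continuous on the unit disc and vanishes near and beyond the unit circle is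
continuous on the plane. -/
theorem continuous_of_eq_zero {ε : ℝ} (hε : 0 < ε) {f : ℂ → ℝ}
    (hc : ContinuousOn f (Metric.ball 0 1))
    (hf : ∀ z, 1 - ‖z‖ ^ 2 ≤ ε → f z = 0) : Continuous f := by
  refine continuous_iff_continuousAt.2 fun z => ?_
  by_cases hz : z ∈ Metric.ball (0 : ℂ) 1
  · exact hc.continuousAt (Metric.isOpen_ball.mem_nhds hz)
  · have : f =ᶠ[𝓝 z] fun _ => 0 := (eventually_le_of_notMem_ball hε hz).mono fun w hw => hf w hw
    exact this.continuousAt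

theorem hasLineDerivAt_of_eq_zero {ε : ℝ} (hε : 0 < ε) {f : ℂ → ℝ} {z : ℂ} (e : ℂ)
    (hz : z ∉ Metric.ball (0 : ℂ) 1) (hf : ∀ z, 1 - ‖z‖ ^ 2 ≤ ε → f z = 0) {d : ℝ} (hd : d = 0) :
    HasLineDerivAt ℝ f d z e := by
  subst hd
  have : f =ᶠ[𝓝 z] fun _ => 0 := (eventually_le_of_notMem_ball hε hz).mono fun w hw => hf w hw
  have h0 : HasLineDerivAt ℝ (fun _ : ℂ => (0 : ℝ)) 0 z e := hasDerivAt_const (0 : ℝ) (0 : ℝ)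
  exact h0.congr_of_eventuallyEq this

/-- The Laplacian of `F(1 - |z|²) ρ(z)` when `log ρ` is locally the real part of a holomorphic
function with derivative `L`: the derivative of `ρ` in the direction `e` is then `ρ Re (e L)`. -/
theorem hasLaplacianOn_profile_mul {p ε : ℝ} (hε : 0 < ε) {ρ : ℂ → ℝ} {L : ℂ → ℂ}
    (hρc : ContinuousOn ρ (Metric.ball 0 1)) (hL : DifferentiableOn ℂ L (Metric.ball 0 1))
    (hρ : ∀ e, ∀ z ∈ Metric.ball (0 : ℂ) 1, HasLineDerivAt ℝ ρ (ρ z * (e * L z).re) z e) :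
    HasLaplacianOn univ (fun z => profile p ε (1 - ‖z‖ ^ 2) * ρ z)
      (fun z => (4 * ‖z‖ ^ 2 * profileDeriv2 p ε (1 - ‖z‖ ^ 2)
        - 4 * profileDeriv p ε (1 - ‖z‖ ^ 2)
        - 4 * profileDeriv p ε (1 - ‖z‖ ^ 2) * (z * L z).re
        + profile p ε (1 - ‖z‖ ^ 2) * ‖L z‖ ^ 2) * ρ z)
      (fun e z => (profileDeriv p ε (1 - ‖z‖ ^ 2) * (-2 * inner ℝ z e)
        + profile p ε (1 - ‖z‖ ^ 2) * (e * L z).re) * ρ z)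
      (fun e z => (profileDeriv2 p ε (1 - ‖z‖ ^ 2) * (-2 * inner ℝ z e) ^ 2
        + profileDeriv p ε (1 - ‖z‖ ^ 2) * (-2 * ‖e‖ ^ 2)
        + 2 * (profileDeriv p ε (1 - ‖z‖ ^ 2) * (-2 * inner ℝ z e) * (e * L z).re)
        + profile p ε (1 - ‖z‖ ^ 2) * (e * (e * deriv L z)).re
        + profile p ε (1 - ‖z‖ ^ 2) * (e * L z).re ^ 2) * ρ z) := by
  have z0 : ∀ z : ℂ, 1 - ‖z‖ ^ 2 ≤ ε → profile p ε (1 - ‖z‖ ^ 2) = 0 := fun z => profile_eq_zero hε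
  have z1 : ∀ z : ℂ, 1 - ‖z‖ ^ 2 ≤ ε → profileDeriv p ε (1 - ‖z‖ ^ 2) = 0 :=
    fun z => profileDeriv_eq_zero hε
  have z2 : ∀ z : ℂ, 1 - ‖z‖ ^ 2 ≤ ε → profileDeriv2 p ε (1 - ‖z‖ ^ 2) = 0 :=
    fun z => profileDeriv2_eq_zero hε
  have out : ∀ z : ℂ, z ∉ Metric.ball (0 : ℂ) 1 → 1 - ‖z‖ ^ 2 ≤ ε := fun z hz => by
    have : 1 ≤ ‖z‖ := by simpa using hz
    nlinarith
  have hv : ∀ z e : ℂ, HasDerivAt (fun t : ℝ => 1 - ‖z + t • e‖ ^ 2) (-2 * inner ℝ z e) 0 :=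
    fun z e => by simpa using (hasDerivAt_line z e 0).norm_sq.const_sub 1
  have hi : ∀ z e : ℂ, HasDerivAt (fun t : ℝ => inner ℝ (z + t • e) e) (‖e‖ ^ 2) 0 := fun z e => by
    simpa using (hasDerivAt_line z e 0).inner ℝ (hasDerivAt_const (0 : ℝ) e)
  have d0 : ∀ z e : ℂ, HasDerivAt (fun t : ℝ => profile p ε (1 - ‖z + t • e‖ ^ 2))
      (profileDeriv p ε (1 - ‖z‖ ^ 2) * (-2 * inner ℝ z e)) 0 := fun z e =>
    (hasDerivAt_profile hε _).comp_of_eq 0 (hv z e) (by simp)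
  have d1 : ∀ z e : ℂ, HasDerivAt (fun t : ℝ => profileDeriv p ε (1 - ‖z + t • e‖ ^ 2))
      (profileDeriv2 p ε (1 - ‖z‖ ^ 2) * (-2 * inner ℝ z e)) 0 := fun z e =>
    (hasDerivAt_profileDeriv hε _).comp_of_eq 0 (hv z e) (by simp)
  have c0 : Continuous fun z : ℂ => profile p ε (1 - ‖z‖ ^ 2) :=
    (continuous_profile hε).comp (by fun_prop)
  have c1 : Continuous fun z : ℂ => profileDeriv p ε (1 - ‖z‖ ^ 2) :=
    (continuous_profileDeriv hε).comp (by fun_prop)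
  have c2 : Continuous fun z : ℂ => profileDeriv2 p ε (1 - ‖z‖ ^ 2) :=
    (continuous_profileDeriv2 hε).comp (by fun_prop)
  have cL : ∀ e, ContinuousOn (fun z => (e * L z).re) (Metric.ball 0 1) := fun e =>
    Complex.continuous_re.comp_continuousOn (hL.continuousOn.const_mul e)
  have cL' : ∀ e, ContinuousOn (fun z => (e * (e * deriv L z)).re) (Metric.ball 0 1) := fun e =>
    Complex.continuous_re.comp_continuousOn
      (((hL.deriv Metric.isOpen_ball).continuousOn.const_mul e).const_mul e)
  have ci : ∀ e : ℂ, Continuous fun z : ℂ => -2 * inner ℝ z e := fun e => by fun_prop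
  constructor
  · intro e z _
    by_cases hz : z ∈ Metric.ball (0 : ℂ) 1
    · refine HasDerivAt.congr_deriv ((d0 z e).mul (hρ e z hz)) ?_
      simp only [zero_smul, add_zero]
      ring
    · refine hasLineDerivAt_of_eq_zero hε e hz (fun w hw => by simp [z0 w hw]) ?_
      simp [z0 z (out z hz), z1 z (out z hz)]
  · intro e z _
    by_cases hz : z ∈ Metric.ball (0 : ℂ) 1
    · have hLz : HasDerivAt (fun t : ℝ => (e * L (z + t • e)).re) (e * (e * deriv L z)).re 0 :=
        ((hL.differentiableAt (Metric.isOpen_ball.mem_nhds hz)).hasDerivAt).hasLineDerivAt_re_mul e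
      refine HasDerivAt.congr_deriv
        ((((d1 z e).mul ((hi z e).const_mul (-2))).add ((d0 z e).mul hLz)).mul (hρ e z hz)) ?_
      simp only [zero_smul, add_zero, Pi.add_apply, Pi.mul_apply]
      ring
    · refine hasLineDerivAt_of_eq_zero hε e hz (fun w hw => by
        simp [z0 w hw, z1 w hw]) ?_
      simp [z0 z (out z hz), z1 z (out z hz), z2 z (out z hz)]
  · refine (continuous_of_eq_zero hε (c0.continuousOn.mul hρc) fun w hw => ?_).continuousOn
    simp [z0 w hw]
  · intro e
    refine (continuous_of_eq_zero hε ?_ fun w hw => ?_).continuousOn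
    · exact ((c1.mul (ci e)).continuousOn.add (c0.continuousOn.mul (cL e))).mul hρc
    · simp [z0 w hw, z1 w hw]
  · intro e
    refine (continuous_of_eq_zero hε ?_ fun w hw => ?_).continuousOn
    · exact ((((((c2.mul ((ci e).pow 2)).add (c1.mul continuous_const)).continuousOn).add
        (((c1.mul (ci e)).continuousOn.mul (cL e)).const_mul 2)).add
        (c0.continuousOn.mul (cL' e))).add (c0.continuousOn.mul ((cL e).pow 2))).mul hρc
    · simp [z0 w hw, z1 w hw, z2 w hw]
  · intro z _
    have hz2 : ‖z‖ ^ 2 = z.re ^ 2 + z.im ^ 2 := by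
      rw [← Complex.normSq_eq_norm_sq, Complex.normSq_apply]; ring
    have hL2 : ‖L z‖ ^ 2 = (L z).re ^ 2 + (L z).im ^ 2 := by
      rw [← Complex.normSq_eq_norm_sq, Complex.normSq_apply]; ring
    generalize profileDeriv2 p ε (1 - ‖z‖ ^ 2) = F2
    generalize profileDeriv p ε (1 - ‖z‖ ^ 2) = F1
    generalize profile p ε (1 - ‖z‖ ^ 2) = F0
    rw [hz2, hL2]
    simp [Complex.inner]
    ring

section weight
variable {n : ℕ} {η : Fin n → ℂ} {q : Fin n → ℝ} {s : ℝ}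

theorem absR_pos {w : ℂ} (hw : ∀ j, w ≠ η j) : 0 < absR η q w :=
  Finset.prod_pos fun j _ => Real.rpow_pos_of_pos (norm_pos_iff.2 (sub_ne_zero.2 (hw j))) _

theorem ne_of_mem_ball (hη : ∀ j, ‖η j‖ = 1) {w : ℂ} (hw : w ∈ Metric.ball (0 : ℂ) 1) (j : Fin n) :
    w ≠ η j := fun h => by
  rw [mem_ball_zero_iff, h, hη j] at hw
  exact lt_irrefl _ hw

theorem continuousOn_absR (hη : ∀ j, ‖η j‖ = 1) :
    ContinuousOn (absR η q) (Metric.ball 0 1) := by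
  unfold absR
  refine continuousOn_finsetProd _ fun j _ => ContinuousOn.rpow_const (by fun_prop) fun w hw => ?_
  exact Or.inl (norm_ne_zero_iff.2 (sub_ne_zero.2 (ne_of_mem_ball hη hw j)))

theorem ofReal_mul_mem_ball (hs : s ∈ Ioo (0 : ℝ) 1) {z : ℂ} (hz : z ∈ Metric.ball (0 : ℂ) 1) :
    (s : ℂ) * z ∈ Metric.ball (0 : ℂ) 1 := by
  rw [mem_ball_zero_iff] at hz ⊢
  rw [norm_mul, Complex.norm_real, Real.norm_of_nonneg hs.1.le]
  nlinarith [hs.1, hs.2, norm_nonneg z]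

/-- The logarithmic derivative `∑ q_j s / (s z - η_j)` of `R(s z)`; the derivative of `log |R(s z)|`
in the direction `e` is the real part of its product with `e`. -/
noncomputable def logDerivR (η : Fin n → ℂ) (q : Fin n → ℝ) (s : ℝ) (z : ℂ) : ℂ :=
  ∑ j, (q j : ℂ) * (s / (s * z - η j))

theorem differentiableOn_logDerivR (hη : ∀ j, ‖η j‖ = 1) (hs : s ∈ Ioo (0 : ℝ) 1) :
    DifferentiableOn ℂ (logDerivR η q s) (Metric.ball 0 1) := by
  unfold logDerivR
  refine DifferentiableOn.fun_sum fun j _ => DifferentiableOn.const_mul ?_ _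
  refine DifferentiableOn.div (by fun_prop) (by fun_prop) fun z hz => ?_
  exact sub_ne_zero.2 (ne_of_mem_ball hη (ofReal_mul_mem_ball hs hz) j)

theorem hasLineDerivAt_absR (hη : ∀ j, ‖η j‖ = 1) (hs : s ∈ Ioo (0 : ℝ) 1) (e : ℂ) {z : ℂ}
    (hz : z ∈ Metric.ball (0 : ℂ) 1) :
    HasLineDerivAt ℝ (fun z : ℂ => absR η q (s * z))
      (absR η q (s * z) * (e * logDerivR η q s z).re) z e := by
  have hne : ∀ z ∈ Metric.ball (0 : ℂ) 1, ∀ j, (s : ℂ) * z - η j ≠ 0 := fun z hz j =>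
    sub_ne_zero.2 (ne_of_mem_ball hη (ofReal_mul_mem_ball hs hz) j)
  have hexp : ∀ z ∈ Metric.ball (0 : ℂ) 1,
      absR η q (s * z) = Real.exp (∑ j, q j * Real.log ‖(s : ℂ) * z - η j‖) := fun z hz => by
    rw [Real.exp_sum, absR]
    refine Finset.prod_congr rfl fun j _ => ?_
    rw [Real.rpow_def_of_pos (norm_pos_iff.2 (hne z hz j)), mul_comm]
  have hj : ∀ j, HasLineDerivAt ℝ (fun z : ℂ => Real.log ‖(s : ℂ) * z - η j‖)
      (e * (s / (s * z - η j))).re z e := fun j => by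
    have : HasDerivAt (fun z : ℂ => (s : ℂ) * z - η j) (s : ℂ) z := by
      simpa using ((hasDerivAt_id z).const_mul (s : ℂ)).sub_const (η j)
    exact this.hasLineDerivAt_log_norm (hne z hz j) e
  have hsum : HasDerivAt (fun t : ℝ => ∑ j, q j * Real.log ‖(s : ℂ) * (z + t • e) - η j‖)
      (∑ j, q j * (e * (s / (s * z - η j))).re) 0 :=
    HasDerivAt.fun_sum fun j _ => HasDerivAt.const_mul (q j) (hj j)
  have hd : HasLineDerivAt ℝ (fun z : ℂ => Real.exp (∑ j, q j * Real.log ‖(s : ℂ) * z - η j‖))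
      (absR η q (s * z) * (e * logDerivR η q s z).re) z e := by
    refine HasDerivAt.congr_deriv hsum.exp ?_
    simp only [zero_smul, add_zero]
    rw [← hexp z hz, logDerivR, Finset.mul_sum (a := e), Complex.re_sum]
    congr 1
    refine Finset.sum_congr rfl fun j _ => ?_
    rw [mul_left_comm, Complex.re_ofReal_mul]
  refine hd.congr_of_eventuallyEq ?_
  filter_upwards [Metric.isOpen_ball.mem_nhds hz] with w hw using hexp w hw

end weight

/-! ### Pointwise bounds for the Laplacian of the test function -/

section estimates
variable {n : ℕ} {η : Fin n → ℂ} {q : Fin n → ℝ} {s : ℝ}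

/-- The map `w ↦ w / (w - ζ)` takes the unit disc into the half plane `Re ≤ 1 / 2`. This is why
positive exponents do no harm in the estimate of `Re (z L)`. -/
theorem re_div_sub_le_half {w ζ : ℂ} (hw : ‖w‖ ≤ 1) (hζ : ‖ζ‖ = 1) : (w / (w - ζ)).re ≤ 1 / 2 := by
  rcases eq_or_ne (w - ζ) 0 with h | h
  · simp [h]
  have hn : 0 < Complex.normSq (w - ζ) := Complex.normSq_pos.2 h
  have hw2 : w.re ^ 2 + w.im ^ 2 ≤ 1 := by
    have := Complex.normSq_eq_norm_sq w
    rw [Complex.normSq_apply] at this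
    nlinarith [norm_nonneg w]
  have hζ2 : ζ.re ^ 2 + ζ.im ^ 2 = 1 := by
    have := Complex.normSq_eq_norm_sq ζ
    rw [Complex.normSq_apply, hζ] at this
    linarith
  rw [Complex.div_re, ← add_div, div_le_iff₀ hn, Complex.normSq_apply]
  simp only [Complex.sub_re, Complex.sub_im]
  nlinarith

theorem half_le_norm_sub (hη : ∀ j, ‖η j‖ = 1) (hs : s ∈ Ioo (0 : ℝ) 1) {z : ℂ}
    (hz : z ∈ Metric.ball (0 : ℂ) 1) (j : Fin n) :
    (1 - ‖z‖ ^ 2) / 2 ≤ ‖(s : ℂ) * z - η j‖ := by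
  rw [mem_ball_zero_iff] at hz
  have h1 : ‖η j‖ - ‖(s : ℂ) * z‖ ≤ ‖(s : ℂ) * z - η j‖ := by
    rw [norm_sub_rev]; exact norm_sub_norm_le _ _
  rw [hη j, norm_mul, Complex.norm_real, Real.norm_of_nonneg hs.1.le] at h1
  nlinarith [norm_nonneg z, hs.1, hs.2]

theorem one_sub_sq_pos {z : ℂ} (hz : z ∈ Metric.ball (0 : ℂ) 1) : 0 < 1 - ‖z‖ ^ 2 := by
  rw [mem_ball_zero_iff] at hz
  nlinarith [norm_nonneg z]

theorem norm_logDerivR_le (hη : ∀ j, ‖η j‖ = 1) (hs : s ∈ Ioo (0 : ℝ) 1) {z : ℂ}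
    (hz : z ∈ Metric.ball (0 : ℂ) 1) :
    ‖logDerivR η q s z‖ ≤ 2 * (∑ j, |q j|) / (1 - ‖z‖ ^ 2) := by
  have hv := one_sub_sq_pos hz
  rw [logDerivR, Finset.mul_sum, Finset.sum_div]
  refine (norm_sum_le _ _).trans (Finset.sum_le_sum fun j _ => ?_)
  have h1 := half_le_norm_sub hη hs hz j
  have h2 : 0 < ‖(s : ℂ) * z - η j‖ := lt_of_lt_of_le (by linarith) h1
  rw [norm_mul, norm_div, Complex.norm_real, Complex.norm_real, Real.norm_eq_abs,
    Real.norm_of_nonneg hs.1.le, mul_comm 2, mul_div_assoc]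
  refine mul_le_mul_of_nonneg_left ?_ (abs_nonneg _)
  rw [div_le_div_iff₀ h2 hv]
  nlinarith [hs.2]

/-- Every point of the plane is within distance `d` of at most one of the points `η j`. -/
theorem exists_separation (hη_inj : Function.Injective η) :
    ∃ d > 0, ∀ w : ℂ, ∀ i j, ‖w - η i‖ < d → ‖w - η j‖ < d → i = j := by
  have : ∀ᶠ d in 𝓝[>] (0 : ℝ), ∀ i j, i ≠ j → 2 * d ≤ ‖η i - η j‖ := by
    refine eventually_all.2 fun i => eventually_all.2 fun j => ?_
    by_cases hij : i = j
    · exact .of_forall fun d h => absurd hij h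
    · have hpos : 0 < ‖η i - η j‖ / 2 := half_pos (norm_pos_iff.2 (sub_ne_zero.2 (hη_inj.ne hij)))
      filter_upwards [Ioo_mem_nhdsGT hpos] with d hd _
      linarith [hd.2]
  obtain ⟨d, hd, hd0⟩ := (this.and self_mem_nhdsWithin).exists
  refine ⟨d, hd0, fun w i j hi hj => ?_⟩
  by_contra hij
  have h1 := hd i j hij
  have h2 : ‖η i - η j‖ ≤ ‖w - η j‖ + ‖w - η i‖ := by
    have := norm_sub_le (w - η j) (w - η i)
    rwa [show w - η j - (w - η i) = η i - η j by ring] at this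
  linarith

/-- The radial derivative of `log |R(s z)|` is at most `K + 2κ / v`, where `v = 1 - |z|²` and `-κ`
is a lower bound for the exponents. The coefficient of `1 / v` does not grow with the number of
points, because only one `η j` can be close to `s z`. -/
theorem exists_re_mul_logDerivR_le (hη : ∀ j, ‖η j‖ = 1) (hη_inj : Function.Injective η)
    {κ : ℝ} (hκ : 0 ≤ κ) (hq : ∀ j, -κ ≤ q j) :
    ∃ K : ℝ, 0 ≤ K ∧ ∀ s ∈ Ioo (0 : ℝ) 1, ∀ z ∈ Metric.ball (0 : ℂ) 1,
      (z * logDerivR η q s z).re ≤ K + 2 * κ / (1 - ‖z‖ ^ 2) := by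
  classical
  obtain ⟨d, hd, hsep⟩ := exists_separation hη_inj
  refine ⟨∑ j, |q j| * (1 / d + 1 / 2), by positivity, fun s hs z hz => ?_⟩
  have hv := one_sub_sq_pos hz
  set w : ℂ := (s : ℂ) * z with hw
  have hwb : ‖w‖ ≤ 1 := (mem_ball_zero_iff.1 (ofReal_mul_mem_ball hs hz)).le
  have hsplit : (z * logDerivR η q s z).re = ∑ j, q j * (w / (w - η j)).re := by
    rw [logDerivR, Finset.mul_sum (a := z), Complex.re_sum]
    refine Finset.sum_congr rfl fun j _ => ?_
    rw [mul_left_comm, Complex.re_ofReal_mul, hw, mul_div_assoc', mul_comm z]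
  have hterm : ∀ j, q j * (w / (w - η j)).re ≤ |q j| * (1 / d + 1 / 2) +
      if ‖w - η j‖ < d then 2 * κ / (1 - ‖z‖ ^ 2) else 0 := fun j => by
    have h1 := half_le_norm_sub hη hs hz j
    have h2 : 0 < ‖w - η j‖ := lt_of_lt_of_le (by linarith) h1
    have h3 : |(w / (w - η j)).re| ≤ 1 / ‖w - η j‖ :=
      (Complex.abs_re_le_norm _).trans (by rw [norm_div]; gcongr)
    have hq0 := abs_nonneg (q j)
    have hd1 : 0 < 1 / d := by positivity
    split_ifs with hnear
    · rcases le_total 0 (q j) with h | h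
      · have := re_div_sub_le_half hwb (hη j)
        have h5 : 0 ≤ 2 * κ / (1 - ‖z‖ ^ 2) := by positivity
        rw [abs_of_nonneg h]
        nlinarith
      · have h4 : 1 / ‖w - η j‖ ≤ 2 / (1 - ‖z‖ ^ 2) := by
          rw [div_le_div_iff₀ h2 hv]; linarith
        calc q j * (w / (w - η j)).re ≤ |q j| * |(w / (w - η j)).re| := by
              rw [← abs_mul]; exact le_abs_self _
          _ ≤ κ * (2 / (1 - ‖z‖ ^ 2)) := by
              refine mul_le_mul ?_ (h3.trans h4) (abs_nonneg _) hκ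
              rw [abs_of_nonpos h]; linarith [hq j]
          _ ≤ _ := by
              have : 0 ≤ |q j| * (1 / d + 1 / 2) := by positivity
              have e : κ * (2 / (1 - ‖z‖ ^ 2)) = 2 * κ / (1 - ‖z‖ ^ 2) := by ring
              linarith
    · have h4 : 1 / ‖w - η j‖ ≤ 1 / d := by gcongr; exact not_lt.1 hnear
      calc q j * (w / (w - η j)).re ≤ |q j| * |(w / (w - η j)).re| := by
              rw [← abs_mul]; exact le_abs_self _
        _ ≤ |q j| * (1 / d + 1 / 2) := by gcongr; linarith
        _ = _ := (add_zero _).symm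
  rw [hsplit]
  refine (Finset.sum_le_sum fun j _ => hterm j).trans ?_
  rw [Finset.sum_add_distrib]
  gcongr
  rw [← Finset.sum_filter, Finset.sum_const, nsmul_eq_mul]
  refine mul_le_of_le_one_left (by positivity) ?_
  have : (Finset.univ.filter fun j => ‖w - η j‖ < d).card ≤ 1 :=
    Finset.card_le_one.2 fun i hi j hj =>
      hsep w i j (Finset.mem_filter.1 hi).2 (Finset.mem_filter.1 hj).2
  exact_mod_cast this

/-- The quotient of the Laplacian of `F(1 - |z|²) ρ(z)` by `ρ(z)`, where `L` is the derivative of a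
holomorphic function with real part `log ρ`; see `hasLaplacianOn_profile_mul`. -/
noncomputable def laplacianFactor (p ε : ℝ) (L : ℂ → ℂ) (z : ℂ) : ℝ :=
  4 * ‖z‖ ^ 2 * profileDeriv2 p ε (1 - ‖z‖ ^ 2)
    - 4 * profileDeriv p ε (1 - ‖z‖ ^ 2)
    - 4 * profileDeriv p ε (1 - ‖z‖ ^ 2) * (z * L z).re
    + profile p ε (1 - ‖z‖ ^ 2) * ‖L z‖ ^ 2

theorem abs_laplacianFactor_le {p ε Q : ℝ} (hp : 0 < p) (hε : 0 < ε) {L : ℂ → ℂ} {z : ℂ}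
    (hz : z ∈ Metric.ball (0 : ℂ) 1) (hL : ‖L z‖ ≤ 2 * Q / (1 - ‖z‖ ^ 2)) :
    |laplacianFactor p ε L z| ≤
      (4 + 4 / p + 8 * Q / p + 4 * Q ^ 2 / p) * (1 - ‖z‖ ^ 2) ^ (p - 1) := by
  have hv := one_sub_sq_pos hz
  have hz1 : ‖z‖ ≤ 1 := (mem_ball_zero_iff.1 hz).le
  rw [laplacianFactor]
  have hv1 : 1 - ‖z‖ ^ 2 ≤ 1 := by nlinarith [norm_nonneg z]
  have hz2 : ‖z‖ ^ 2 ≤ 1 := by nlinarith [norm_nonneg z]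
  set v := 1 - ‖z‖ ^ 2
  have b2 := profileDeriv2_le (p := p) hε hv
  have b1 := mul_profileDeriv_le_rpow hp hε hv
  have b0 := profile_le (p := p) hε hv
  have n2 := profileDeriv2_nonneg (p := p) hε v
  have n1 := profileDeriv_nonneg (p := p) hε v
  have n0 := profile_nonneg (p := p) hε v
  have hX : |(z * L z).re| ≤ 2 * Q / v := by
    refine (Complex.abs_re_le_norm _).trans ?_
    rw [norm_mul]
    exact (mul_le_of_le_one_left (norm_nonneg _) hz1).trans hL
  set X := (z * L z).re
  set F2 := profileDeriv2 p ε v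
  set F1 := profileDeriv p ε v
  set F0 := profile p ε v
  set P := v ^ (p - 1) with hP
  have hP0 : 0 ≤ P := Real.rpow_nonneg hv.le _
  have b1' : F1 ≤ v * P / p := by rw [le_div_iff₀ hp]; linarith
  have t1 : 4 * ‖z‖ ^ 2 * F2 ≤ 4 * P := by nlinarith [sq_nonneg ‖z‖]
  have t2 : 4 * F1 ≤ 4 / p * P := by
    calc 4 * F1 ≤ 4 * (v * P / p) := by gcongr
      _ ≤ 4 * (1 * P / p) := by gcongr
      _ = _ := by ring
  have t3 : |4 * F1 * X| ≤ 8 * Q / p * P := by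
    rw [abs_mul, abs_of_nonneg (by positivity)]
    calc 4 * F1 * |X| ≤ 4 * (v * P / p) * (2 * Q / v) := by gcongr
      _ = _ := by field_simp; ring
  have t4 : F0 * ‖L z‖ ^ 2 ≤ 4 * Q ^ 2 / p * P := by
    calc F0 * ‖L z‖ ^ 2 ≤ (v * (v * P / p)) * (2 * Q / v) ^ 2 := by
          gcongr; exact b0.trans (by gcongr)
      _ = _ := by field_simp; ring
  have t5 : 0 ≤ F0 * ‖L z‖ ^ 2 := by positivity
  have t6 : 0 ≤ 4 * ‖z‖ ^ 2 * F2 := by positivity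
  rw [abs_le] at t3 ⊢
  constructor <;> nlinarith [t3.1, t3.2]

/-- The test function is subharmonic near the unit circle: where `v = 1 - |z|²` is small, the term
`4 |z|² F'' ≥ 4 p |z|² F' / v` outweighs `4 F' Re (z L) ≤ 4 F' (K + 2κ / v)`, as `2κ < p`. -/
theorem laplacianFactor_nonneg {p ε K κ : ℝ} (hp : 0 < p) (hε : 0 < ε) {L : ℂ → ℂ} {z : ℂ}
    (hz : z ∈ Metric.ball (0 : ℂ) 1)
    (hL : (z * L z).re ≤ K + 2 * κ / (1 - ‖z‖ ^ 2))
    (hv0 : (1 - ‖z‖ ^ 2) * (p + 1 + K) ≤ p - 2 * κ) : 0 ≤ laplacianFactor p ε L z := by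
  have hv := one_sub_sq_pos hz
  rw [laplacianFactor]
  have e : ‖z‖ ^ 2 = 1 - (1 - ‖z‖ ^ 2) := by ring
  have hz2 := sq_nonneg ‖z‖
  set v := 1 - ‖z‖ ^ 2
  have b1 := mul_profileDeriv_le hp hε hv
  have n1 := profileDeriv_nonneg (p := p) hε v
  have n0 := profile_nonneg (p := p) hε v
  set X := (z * L z).re
  set F2 := profileDeriv2 p ε v
  set F1 := profileDeriv p ε v
  set F0 := profile p ε v
  have t5 : 0 ≤ F0 * ‖L z‖ ^ 2 := by positivity
  have h1 : ‖z‖ ^ 2 * (p * F1) ≤ ‖z‖ ^ 2 * (v * F2) := by gcongr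
  have h2 : F1 * (v * X) ≤ F1 * (v * K + 2 * κ) := by
    gcongr
    calc v * X ≤ v * (K + 2 * κ / v) := by gcongr
      _ = _ := by field_simp
  have h3 : F1 * (v * (p + 1 + K)) ≤ F1 * (p - 2 * κ) := by gcongr
  have h4 : 0 ≤ v * (‖z‖ ^ 2 * F2 - F1 - F1 * X) := by
    rw [e] at h1 ⊢
    nlinarith
  have h5 := nonneg_of_mul_nonneg_right h4 hv
  linarith

end estimates

/-! ### The inequality for functions analytic on the closed disc -/

theorem IsCompact.exists_pos_bounds {K : Set ℂ} (hK : IsCompact K) (hne : K.Nonempty) {f : ℂ → ℝ}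
    (hf : ContinuousOn f K) (hpos : ∀ z ∈ K, 0 < f z) :
    ∃ m M : ℝ, 0 < m ∧ ∀ z ∈ K, m ≤ f z ∧ f z ≤ M := by
  obtain ⟨x, hx, hmin⟩ := hK.exists_isMinOn hne hf
  obtain ⟨y, hy, hmax⟩ := hK.exists_isMaxOn hne hf
  exact ⟨f x, f y, hpos x hx, fun z hz => ⟨hmin hz, hmax hz⟩⟩

/-- If adding `B` on the disc of radius `r` makes the weight `Λ` nonnegative, then `log |g|` may be
replaced by `log⁺ |g|`: the added term contributes a nonnegative amount, as the integral of
`log |g|` over that disc is nonnegative. -/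
theorem integral_log_norm_mul_le {g : ℂ → ℂ} (hg : AnalyticOnNhd ℂ g (Metric.closedBall 0 1))
    (h0 : ‖g 0‖ = 1) {Λ w : ℂ → ℝ} (hΛ : Continuous Λ) (hcΛ : HasCompactSupport Λ) {r B C : ℝ}
    (hr : r ≤ 1) (hB : 0 ≤ B)
    (hnonneg : ∀ z ∈ Metric.ball (0 : ℂ) 1,
      0 ≤ Λ z + (Metric.ball (0 : ℂ) r).indicator (fun _ => B) z)
    (hle : ∀ z ∈ Metric.ball (0 : ℂ) 1,
      Λ z + (Metric.ball (0 : ℂ) r).indicator (fun _ => B) z ≤ C * w z) (hC : 0 ≤ C) :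
    ENNReal.ofReal (∫ z in Metric.ball (0 : ℂ) 1, Real.log ‖g z‖ * Λ z) ≤
      ENNReal.ofReal C * ∫⁻ z in Metric.ball (0 : ℂ) 1,
        ENNReal.ofReal (w z * Real.posLog ‖g z‖) := by
  have hg0 : g 0 ≠ 0 := by rw [← norm_ne_zero_iff, h0]; simp
  have hi : IntegrableOn (fun z => Real.log ‖g z‖) (Metric.ball 0 1) :=
    (hg.integrableOn_log_norm hg0).mono_set Metric.ball_subset_closedBall
  set I : ℂ → ℝ := (Metric.ball (0 : ℂ) r).indicator fun _ => B with hI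
  have hIm : Measurable I := measurable_const.indicator measurableSet_ball
  have hIb : ∀ z, ‖I z‖ ≤ B := fun z => by
    rw [hI, norm_indicator_eq_indicator_norm, Real.norm_of_nonneg hB]
    exact indicator_le_self' (fun _ _ => hB) z
  obtain ⟨b, hb⟩ := hΛ.bounded_above_of_compact_support hcΛ
  have hiΛ : IntegrableOn (fun z => Real.log ‖g z‖ * Λ z) (Metric.ball 0 1) :=
    hi.mul_bdd hΛ.aestronglyMeasurable (.of_forall hb)
  have hiI : IntegrableOn (fun z => Real.log ‖g z‖ * I z) (Metric.ball 0 1) :=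
    hi.mul_bdd hIm.aestronglyMeasurable (.of_forall hIb)
  have hpos : IntegrableOn (fun z => Real.posLog ‖g z‖) (Metric.ball 0 1) := by
    refine hi.pos_part.congr (.of_forall fun z => ?_)
    simp [Real.posLog, max_comm]
  have hiW : IntegrableOn (fun z => Real.posLog ‖g z‖ * (Λ z + I z)) (Metric.ball 0 1) := by
    simp only [mul_add]
    exact (hpos.mul_bdd hΛ.aestronglyMeasurable (.of_forall hb)).add
      (hpos.mul_bdd hIm.aestronglyMeasurable (.of_forall hIb))
  have hI0 : 0 ≤ ∫ z in Metric.ball (0 : ℂ) 1, Real.log ‖g z‖ * I z := by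
    have e : (fun z => Real.log ‖g z‖ * I z) =
        (Metric.ball (0 : ℂ) r).indicator fun z => B * Real.log ‖g z‖ := by
      ext z
      by_cases hz : z ∈ Metric.ball (0 : ℂ) r
      · simp only [hI, indicator_of_mem hz]; ring
      · simp only [hI, indicator_of_notMem hz, mul_zero]
    rw [e, setIntegral_indicator measurableSet_ball,
      inter_eq_self_of_subset_right (Metric.ball_subset_ball hr), integral_const_mul]
    exact mul_nonneg hB (hg.setIntegral_log_norm_nonneg h0 hr)
  have h1 : ∫ z in Metric.ball (0 : ℂ) 1, Real.log ‖g z‖ * Λ z ≤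
      ∫ z in Metric.ball (0 : ℂ) 1, Real.posLog ‖g z‖ * (Λ z + I z) := by
    calc ∫ z in Metric.ball (0 : ℂ) 1, Real.log ‖g z‖ * Λ z
        ≤ (∫ z in Metric.ball (0 : ℂ) 1, Real.log ‖g z‖ * Λ z) +
          ∫ z in Metric.ball (0 : ℂ) 1, Real.log ‖g z‖ * I z := le_add_of_nonneg_right hI0
      _ = ∫ z in Metric.ball (0 : ℂ) 1, Real.log ‖g z‖ * (Λ z + I z) := by
          simp only [mul_add]
          exact (integral_add hiΛ hiI).symm
      _ ≤ _ := by
          refine setIntegral_mono_on ?_ hiW measurableSet_ball fun z hz => ?_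
          · simp only [mul_add]
            exact hiΛ.add hiI
          · exact mul_le_mul_of_nonneg_right (le_max_right _ _) (hnonneg z hz)
  refine (ENNReal.ofReal_le_ofReal h1).trans ?_
  rw [ofReal_integral_eq_lintegral_ofReal hiW, ← lintegral_const_mul' _ _ ENNReal.ofReal_ne_top]
  · refine setLIntegral_mono' measurableSet_ball fun z hz => ?_
    rw [← ENNReal.ofReal_mul hC]
    refine ENNReal.ofReal_le_ofReal ?_
    calc Real.posLog ‖g z‖ * (Λ z + I z) ≤ Real.posLog ‖g z‖ * (C * w z) :=
          mul_le_mul_of_nonneg_left (hle z hz) Real.posLog_nonneg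
      _ = _ := by ring
  · filter_upwards [ae_restrict_mem measurableSet_ball] with z hz
    exact mul_nonneg Real.posLog_nonneg (hnonneg z hz)

/-- The inequality for a function analytic on the closed unit disc, with a constant that does not
depend on the dilation parameter `s` of the weight. -/
theorem exists_sum_zeros_le {n : ℕ} {η : Fin n → ℂ} {q : Fin n → ℝ} {p : ℝ} (hp : 0 < p)
    (hη : ∀ j, ‖η j‖ = 1) (hη_inj : Function.Injective η) (hq : ∀ j, -p / 2 < q j) :
    ∃ C : NNReal, ∀ s ∈ Ioo (0 : ℝ) 1, ∀ g : ℂ → ℂ, AnalyticOnNhd ℂ g (Metric.closedBall 0 1) →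
      ‖g 0‖ = 1 → ∀ S : Finset ℂ, (∀ a ∈ S, a ∈ Metric.ball (0 : ℂ) 1) →
      ENNReal.ofReal (∑ a ∈ S, (analyticOrderNatAt g a : ℝ) *
        ((1 - ‖a‖ ^ 2) ^ (1 + p) * absR η q (s * a))) ≤
      C * ∫⁻ z in Metric.ball (0 : ℂ) 1, ENNReal.ofReal
        ((1 - ‖z‖ ^ 2) ^ (p - 1) * absR η q (s * z) * Real.posLog ‖g z‖) := by
  obtain ⟨κ, hκ0, hκp, hqκ⟩ : ∃ κ : ℝ, 0 ≤ κ ∧ κ < p / 2 ∧ ∀ j, -κ ≤ q j := by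
    have : ∀ᶠ κ in 𝓝[<] (p / 2), 0 ≤ κ ∧ ∀ j, -κ ≤ q j := by
      refine Filter.Eventually.and ?_ (eventually_all.2 fun j => ?_)
      · filter_upwards [Ioo_mem_nhdsLT (half_pos hp)] with κ hκ using hκ.1.le
      · have : -q j < p / 2 := by linarith [hq j]
        filter_upwards [Ioo_mem_nhdsLT this] with κ hκ
        linarith [hκ.1]
    obtain ⟨κ, ⟨h1, h2⟩, h3⟩ := (this.and self_mem_nhdsWithin).exists
    exact ⟨κ, h1, h3, h2⟩
  obtain ⟨K, hK0, hK⟩ := exists_re_mul_logDerivR_le hη hη_inj hκ0 hqκ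
  -- The Laplacian of the test function is nonnegative where `1 - |z|² ≤ v₀`, that is, outside the
  -- disc of radius `r`.
  set v₀ : ℝ := (p - 2 * κ) / (p + 1 + K) with hv₀
  have hv₀0 : 0 < v₀ := div_pos (by linarith) (by linarith)
  have hv₀1 : v₀ < 1 := by rw [hv₀, div_lt_one (by linarith)]; linarith
  set r : ℝ := √(1 - v₀) with hr
  have hr0 : 0 ≤ r := Real.sqrt_nonneg _
  have hrsq : r ^ 2 = 1 - v₀ := Real.sq_sqrt (by linarith)
  have hr1 : r < 1 := by nlinarith
  have hrball : Metric.closedBall (0 : ℂ) r ⊆ Metric.ball 0 1 := Metric.closedBall_subset_ball hr1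
  -- On `|z| ≤ r` the weight `(1 - |z|²) ^ (p - 1) ρ(z)` lies between `m₂ m₁` and `M₂ M₁`, uniformly
  -- in `s`, because the disc is invariant under multiplication by `s`.
  obtain ⟨m₁, M₁, hm₁, hb₁⟩ := (isCompact_closedBall (0 : ℂ) r).exists_pos_bounds ⟨0, by simpa⟩
    ((continuousOn_absR (q := q) hη).mono hrball)
    fun z hz => absR_pos (ne_of_mem_ball hη (hrball hz))
  obtain ⟨m₂, M₂, hm₂, hb₂⟩ := (isCompact_closedBall (0 : ℂ) r).exists_pos_bounds ⟨0, by simpa⟩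
    (f := fun z => (1 - ‖z‖ ^ 2) ^ (p - 1))
    (ContinuousOn.rpow_const (by fun_prop) fun z hz => Or.inl (one_sub_sq_pos (hrball hz)).ne')
    fun z hz => Real.rpow_pos_of_pos (one_sub_sq_pos (hrball hz)) _
  have hM₁ : 0 < M₁ := hm₁.trans_le ((hb₁ 0 (by simpa)).1.trans (hb₁ 0 (by simpa)).2)
  have hM₂ : 0 < M₂ := hm₂.trans_le ((hb₂ 0 (by simpa)).1.trans (hb₂ 0 (by simpa)).2)
  set Q : ℝ := ∑ j, |q j| with hQ
  have hQ0 : 0 ≤ Q := Finset.sum_nonneg fun j _ => abs_nonneg _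
  set C₁ : ℝ := 4 + 4 / p + 8 * Q / p + 4 * Q ^ 2 / p with hC₁
  have hC₁0 : 0 < C₁ := by positivity
  set B : ℝ := C₁ * (M₂ * M₁) with hB
  set C₂ : ℝ := C₁ + B / (m₂ * m₁) with hC₂
  have hC₂0 : 0 ≤ C₂ := by positivity
  set c : ℝ := min 1 ((1 / 2 : ℝ) ^ (p - 1)) / 16 with hc
  have hc0 : 0 < c := by
    have : 0 < min 1 ((1 / 2 : ℝ) ^ (p - 1)) := lt_min one_pos (by positivity)
    positivity
  refine ⟨(C₂ / (2 * Real.pi * c)).toNNReal, fun s hs g hg hg0 S hS => ?_⟩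
  -- The cutoff parameter is chosen small enough for all the points of `S`.
  obtain ⟨ε, hεS, hε⟩ : ∃ ε : ℝ, (∀ a ∈ S, 4 * ε ≤ 1 - ‖a‖ ^ 2) ∧ 0 < ε := by
    have : ∀ᶠ ε in 𝓝[>] (0 : ℝ), ∀ a ∈ S, 4 * ε ≤ 1 - ‖a‖ ^ 2 := by
      refine S.eventually_all.2 fun a ha => ?_
      have hpos : 0 < (1 - ‖a‖ ^ 2) / 4 := by linarith [one_sub_sq_pos (hS a ha)]
      filter_upwards [Ioo_mem_nhdsGT hpos] with ε hε
      linarith [hε.2]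
    exact (this.and self_mem_nhdsWithin).exists
  set ρ : ℂ → ℝ := fun z => absR η q (s * z) with hρ
  set L : ℂ → ℂ := logDerivR η q s with hL
  have hρpos : ∀ z ∈ Metric.ball (0 : ℂ) 1, 0 < ρ z := fun z hz =>
    absR_pos (ne_of_mem_ball hη (ofReal_mul_mem_ball hs hz))
  have hρc : ContinuousOn ρ (Metric.ball 0 1) :=
    (continuousOn_absR hη).comp (by fun_prop) fun z hz => ofReal_mul_mem_ball hs hz
  have hLd : DifferentiableOn ℂ L (Metric.ball 0 1) := differentiableOn_logDerivR hη hs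
  have hlap := hasLaplacianOn_profile_mul (p := p) hε hρc hLd
    fun e z hz => hasLineDerivAt_absR hη hs e hz
  set φ : ℂ → ℝ := fun z => profile p ε (1 - ‖z‖ ^ 2) * ρ z with hφ
  set Λ : ℂ → ℝ := fun z => laplacianFactor p ε L z * ρ z with hΛ
  have hΛ0 : ∀ z, 1 - ‖z‖ ^ 2 ≤ ε → Λ z = 0 := fun z hz => by
    simp [hΛ, laplacianFactor, profile_eq_zero hε hz, profileDeriv_eq_zero hε hz,
      profileDeriv2_eq_zero hε hz]
  have hφ0 : ∀ z, 1 - ‖z‖ ^ 2 ≤ ε → φ z = 0 := fun z hz => by simp [hφ, profile_eq_zero hε hz]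
  have hφU := tsupport_subset_ball_of_eq_zero hε hφ0
  have hΛU := tsupport_subset_ball_of_eq_zero hε hΛ0
  have hΛc : Continuous Λ := by
    refine (continuousOn_univ.1 ((hlap.continuousOn_deriv2 1).add
      (hlap.continuousOn_deriv2 Complex.I))).congr fun z => ?_
    exact (hlap.eq_add z trivial).symm
  have hφnn : ∀ z, 0 ≤ φ z := fun z =>
    mul_nonneg (profile_nonneg hε _) (Finset.prod_nonneg fun j _ => by positivity)
  have hg0' : g 0 ≠ 0 := by rw [← norm_ne_zero_iff, hg0]; simp
  have hriesz := hg.sum_zeros_le_integral hg0' hlap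
    (hasCompactSupport_of_tsupport_subset_ball hφU) hφU hΛc hΛU hφnn S hS
  have habs : ∀ z ∈ Metric.ball (0 : ℂ) 1, |Λ z| ≤ C₁ * ((1 - ‖z‖ ^ 2) ^ (p - 1) * ρ z) :=
    fun z hz => by
      rw [hΛ, abs_mul, abs_of_pos (hρpos z hz), ← mul_assoc]
      exact mul_le_mul_of_nonneg_right
        (abs_laplacianFactor_le hp hε hz (norm_logDerivR_le hη hs hz)) (hρpos z hz).le
  have hinner : ∀ z ∈ Metric.ball (0 : ℂ) r,
      m₂ * m₁ ≤ (1 - ‖z‖ ^ 2) ^ (p - 1) * ρ z ∧ (1 - ‖z‖ ^ 2) ^ (p - 1) * ρ z ≤ M₂ * M₁ :=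
    fun z hz => by
      have hz' := Metric.ball_subset_closedBall hz
      have hsz : (s : ℂ) * z ∈ Metric.closedBall (0 : ℂ) r := by
        rw [mem_closedBall_zero_iff] at hz' ⊢
        rw [norm_mul, Complex.norm_real, Real.norm_of_nonneg hs.1.le]
        nlinarith [hs.1, hs.2, norm_nonneg z]
      have h1 := hb₁ _ hsz
      have h2 := hb₂ z hz'
      have hp1 : 0 ≤ ρ z := hm₁.le.trans h1.1
      exact ⟨mul_le_mul h2.1 h1.1 hm₁.le (hm₂.le.trans h2.1), mul_le_mul h2.2 h1.2 hp1 hM₂.le⟩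
  have hmain := integral_log_norm_mul_le hg hg0 hΛc (hasCompactSupport_of_tsupport_subset_ball hΛU)
    (w := fun z => (1 - ‖z‖ ^ 2) ^ (p - 1) * ρ z) (r := r) (B := B) (C := C₂) hr1.le
    (by positivity) (fun z hz => ?_) (fun z hz => ?_) hC₂0
  · have hlow : c * ∑ a ∈ S, (analyticOrderNatAt g a : ℝ) * ((1 - ‖a‖ ^ 2) ^ (1 + p) * ρ a) ≤
        ∑ a ∈ S, (analyticOrderNatAt g a : ℝ) * φ a := by
      rw [Finset.mul_sum]
      refine Finset.sum_le_sum fun a ha => ?_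
      calc c * ((analyticOrderNatAt g a : ℝ) * ((1 - ‖a‖ ^ 2) ^ (1 + p) * ρ a))
          = (analyticOrderNatAt g a : ℝ) * (c * (1 - ‖a‖ ^ 2) ^ (1 + p) * ρ a) := by ring
        _ ≤ _ := mul_le_mul_of_nonneg_left (mul_le_mul_of_nonneg_right
          (rpow_le_profile hε (hεS a ha)) (hρpos a (hS a ha)).le) (Nat.cast_nonneg _)
    have hpic : 0 < 2 * Real.pi * c := by positivity
    have hle : ∑ a ∈ S, (analyticOrderNatAt g a : ℝ) * ((1 - ‖a‖ ^ 2) ^ (1 + p) * ρ a) ≤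
        (2 * Real.pi * c)⁻¹ * ∫ z in Metric.ball (0 : ℂ) 1, Real.log ‖g z‖ * Λ z := by
      rw [le_inv_mul_iff₀ hpic, mul_assoc]
      exact (mul_le_mul_of_nonneg_left hlow (by positivity)).trans hriesz
    refine (ENNReal.ofReal_le_ofReal hle).trans ?_
    rw [ENNReal.ofReal_mul (by positivity)]
    refine (mul_le_mul_right hmain _).trans ?_
    rw [← mul_assoc, ← ENNReal.ofReal_mul (by positivity), inv_mul_eq_div]
    rfl
  · by_cases hzr : z ∈ Metric.ball (0 : ℂ) r
    · rw [indicator_of_mem hzr]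
      have h1 := (abs_le.1 (habs z hz)).1
      have h2 := mul_le_mul_of_nonneg_left (hinner z hzr).2 hC₁0.le
      linarith
    · rw [indicator_of_notMem hzr, add_zero]
      refine mul_nonneg (laplacianFactor_nonneg (K := K) (κ := κ) hp hε hz (hK s hs z hz) ?_)
        (hρpos z hz).le
      have h1 : r ≤ ‖z‖ := by simpa using hzr
      have h2 : 1 - ‖z‖ ^ 2 ≤ v₀ := by nlinarith
      rwa [hv₀, le_div_iff₀ (by linarith)] at h2
  · have h1 := (le_abs_self _).trans (habs z hz)
    by_cases hzr : z ∈ Metric.ball (0 : ℂ) r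
    · rw [indicator_of_mem hzr, hC₂, add_mul]
      refine add_le_add h1 ?_
      rw [div_mul_eq_mul_div, le_div_iff₀ (by positivity)]
      exact mul_le_mul_of_nonneg_left (hinner z hzr).1 (by positivity)
    · rw [indicator_of_notMem hzr, add_zero]
      refine h1.trans (mul_le_mul_of_nonneg_right ?_ ?_)
      · rw [hC₂]; exact le_add_of_nonneg_right (by positivity)
      · exact mul_nonneg (Real.rpow_nonneg (one_sub_sq_pos hz).le _) (hρpos z hz).le

/-! ### Dilations and passage to the limit -/

theorem absR_le_of_le {n : ℕ} {η : Fin n → ℂ} (hη : ∀ j, ‖η j‖ = 1) {q q' : Fin n → ℝ}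
    (hq : ∀ j, q j ≤ q' j) {w : ℂ} (hw : w ∈ Metric.ball (0 : ℂ) 1) :
    absR η q' w ≤ (∏ j, (2 : ℝ) ^ (q' j - q j)) * absR η q w := by
  rw [absR, absR, ← Finset.prod_mul_distrib]
  refine Finset.prod_le_prod (fun j _ => by positivity) fun j _ => ?_
  have h0 : 0 < ‖w - η j‖ := norm_pos_iff.2 (sub_ne_zero.2 (ne_of_mem_ball hη hw j))
  have h2 : ‖w - η j‖ ≤ 2 := by
    have := norm_sub_le w (η j)
    rw [hη j] at this
    linarith [mem_ball_zero_iff.1 hw]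
  calc ‖w - η j‖ ^ q' j = ‖w - η j‖ ^ (q' j - q j) * ‖w - η j‖ ^ q j := by
        rw [← Real.rpow_add h0, sub_add_cancel]
    _ ≤ _ := by gcongr; exact sub_nonneg.2 (hq j)

theorem lintegral_le_nevanlinnaNorm {n : ℕ} {η : Fin n → ℂ} (hη : ∀ j, ‖η j‖ = 1)
    {q q' : Fin n → ℝ} (hq : ∀ j, q j ≤ q' j) {p δ s : ℝ} (hδ : δ ∈ Ioo (0 : ℝ) 1)
    (hs : s ∈ Ioo (1 - δ) 1) (f : ℂ → ℂ) :
    ∫⁻ z in Metric.ball (0 : ℂ) 1, ENNReal.ofReal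
        ((1 - ‖z‖ ^ 2) ^ (p - 1) * absR η q' (s * z) * Real.posLog ‖f (s * z)‖) ≤
      ENNReal.ofReal (∏ j, (2 : ℝ) ^ (q' j - q j)) * nevanlinnaNorm (absR η q) p δ f := by
  have hs' : s ∈ Ioo (0 : ℝ) 1 := ⟨by linarith [hs.1, hδ.2], hs.2⟩
  have hM : 0 ≤ ∏ j, (2 : ℝ) ^ (q' j - q j) := Finset.prod_nonneg fun j _ => by positivity
  refine le_trans ?_ (mul_le_mul_right (le_iSup₂ (f := fun (s : ℝ) (_ : s ∈ Ioo (1 - δ) 1) =>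
    ∫⁻ z in Metric.ball (0 : ℂ) 1, ENNReal.ofReal ((1 - ‖z‖ ^ 2) ^ (p - 1) *
      absR η q ((s : ℂ) * z) * Real.posLog ‖f ((s : ℂ) * z)‖)) s hs) _)
  rw [← lintegral_const_mul' _ _ ENNReal.ofReal_ne_top]
  refine setLIntegral_mono' measurableSet_ball fun z hz => ?_
  rw [← ENNReal.ofReal_mul hM]
  refine ENNReal.ofReal_le_ofReal ?_
  have h1 := absR_le_of_le hη hq (ofReal_mul_mem_ball hs' hz)
  have h2 : 0 ≤ (1 - ‖z‖ ^ 2) ^ (p - 1) := Real.rpow_nonneg (one_sub_sq_pos hz).le _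
  calc _ ≤ (1 - ‖z‖ ^ 2) ^ (p - 1) * ((∏ j, (2 : ℝ) ^ (q' j - q j)) * absR η q (s * z)) *
        Real.posLog ‖f (s * z)‖ :=
        mul_le_mul_of_nonneg_right (mul_le_mul_of_nonneg_left h1 h2) Real.posLog_nonneg
    _ = _ := by ring

theorem analyticOrderNatAt_comp_const_mul (f : ℂ → ℂ) {c : ℂ} (hc : c ≠ 0) (a : ℂ) :
    analyticOrderNatAt (fun z => f (c * z)) (a / c) = analyticOrderNatAt f a := by
  have h := analyticOrderAt_comp_of_deriv_ne_zero (f := f) (g := fun z => c * z) (z₀ := a / c)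
    (by fun_prop) (by rw [deriv_const_mul_field]; simpa)
  rw [mul_div_cancel₀ _ hc] at h
  rw [analyticOrderNatAt, analyticOrderNatAt, ← h]
  rfl

theorem mainTheorem1 (n : ℕ) (η : Fin n → ℂ) (hη : ∀ j, ‖η j‖ = 1)
    (hη_inj : Function.Injective η) (q q' : Fin n → ℝ) (p : ℝ) (hp : 0 < p)
    (hq_eq : ∀ j, -p / 2 < q j → q' j = q j)
    (hq_gt : ∀ j, q j ≤ -p / 2 → -p / 2 < q' j) :
    ∃ c : NNReal, ∀ f ∈ nevanlinnaClass (absR η q) p, ‖f 0‖ = 1 →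
      ∀ δ ∈ Set.Ioo (0 : ℝ) 1, nevanlinnaNorm (absR η q) p δ f < ⊤ →
        zeroSum f (fun a => (1 - ‖a‖ ^ 2) ^ (1 + p) * absR η q' a) ≤
          (c : ENNReal) * nevanlinnaNorm (absR η q) p δ f := by
  classical
  have hq' : ∀ j, -p / 2 < q' j := fun j => by
    rcases lt_or_ge (-p / 2) (q j) with h | h
    · rwa [hq_eq j h]
    · exact hq_gt j h
  have hqq' : ∀ j, q j ≤ q' j := fun j => by
    rcases lt_or_ge (-p / 2) (q j) with h | h
    · exact (hq_eq j h).ge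
    · exact h.trans (hq_gt j h).le
  obtain ⟨C, hC⟩ := exists_sum_zeros_le hp hη hη_inj hq'
  refine ⟨C * (∏ j, (2 : ℝ) ^ (q' j - q j)).toNNReal, fun f hf hf0 δ hδ _ => ?_⟩
  have hfd : DifferentiableOn ℂ f (Metric.ball 0 1) := hf.1
  rw [zeroSum, ENNReal.tsum_eq_iSup_sum]
  refine iSup_le fun S => ?_
  set T : Finset ℂ := S.image Subtype.val with hT
  have hTball : ∀ a ∈ T, ‖a‖ < 1 := fun a ha => by
    obtain ⟨b, -, rfl⟩ := Finset.mem_image.1 ha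
    exact mem_ball_zero_iff.1 b.2.1
  have hw : ∀ a ∈ T, 0 ≤ (1 - ‖a‖ ^ 2) ^ (1 + p) * absR η q' a := fun a ha =>
    mul_nonneg (Real.rpow_nonneg (by nlinarith [hTball a ha, norm_nonneg a]) _)
      (Finset.prod_nonneg fun j _ => by positivity)
  have hsum : ∑ a ∈ S, (analyticOrderNatAt f a : ENNReal) *
      ENNReal.ofReal ((1 - ‖(a : ℂ)‖ ^ 2) ^ (1 + p) * absR η q' a) =
      ENNReal.ofReal (∑ a ∈ T, (analyticOrderNatAt f a : ℝ) *
        ((1 - ‖a‖ ^ 2) ^ (1 + p) * absR η q' a)) := by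
    rw [ENNReal.ofReal_sum_of_nonneg fun a ha => mul_nonneg (Nat.cast_nonneg _) (hw a ha), hT,
      Finset.sum_image fun a _ b _ h => Subtype.ext h]
    refine Finset.sum_congr rfl fun a _ => ?_
    rw [ENNReal.ofReal_mul (Nat.cast_nonneg _), ENNReal.ofReal_natCast]
  rw [hsum]
  -- The zeros of `z ↦ f (s z)` are the points `a / s`; their weighted sum tends to that of `f`.
  have hlim : Tendsto (fun s : ℝ => ENNReal.ofReal (∑ a ∈ T, (analyticOrderNatAt f a : ℝ) *
      ((1 - (‖a‖ / s) ^ 2) ^ (1 + p) * absR η q' a))) (𝓝[<] 1)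
      (𝓝 (ENNReal.ofReal (∑ a ∈ T, (analyticOrderNatAt f a : ℝ) *
        ((1 - ‖a‖ ^ 2) ^ (1 + p) * absR η q' a)))) := by
    refine (ENNReal.continuous_ofReal.tendsto _).comp (tendsto_finsetSum _ fun a _ => ?_)
    refine Tendsto.const_mul _ (Tendsto.mul_const _ ?_)
    have h1 : ContinuousAt (fun s : ℝ => (1 - (‖a‖ / s) ^ 2) ^ (1 + p)) 1 := by
      refine ContinuousAt.rpow_const ?_ (Or.inr (by linarith))
      exact continuousAt_const.sub ((continuousAt_const.div continuousAt_id one_ne_zero).pow 2)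
    simpa using h1.tendsto.mono_left nhdsWithin_le_nhds
  refine le_of_tendsto hlim ?_
  have hev : ∀ᶠ s : ℝ in 𝓝[<] 1, ∀ a ∈ T, ‖a‖ < s := T.eventually_all.2 fun a ha =>
    mem_of_superset (Ioo_mem_nhdsLT (hTball a ha)) fun s hs => hs.1
  filter_upwards [hev, Ioo_mem_nhdsLT (show 1 - δ < 1 by linarith [hδ.1])] with s hTs hs
  have hs' : s ∈ Ioo (0 : ℝ) 1 := ⟨by linarith [hs.1, hδ.2], hs.2⟩
  have hsc : (s : ℂ) ≠ 0 := Complex.ofReal_ne_zero.2 hs'.1.ne'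
  have hg : AnalyticOnNhd ℂ (fun z => f ((s : ℂ) * z)) (Metric.closedBall 0 1) := fun z hz => by
    have hsz : (s : ℂ) * z ∈ Metric.ball (0 : ℂ) 1 := by
      rw [mem_closedBall_zero_iff] at hz
      rw [mem_ball_zero_iff, norm_mul, Complex.norm_real, Real.norm_of_nonneg hs'.1.le]
      nlinarith [hs'.1, hs'.2]
    exact (hfd.analyticOnNhd Metric.isOpen_ball _ hsz).fun_comp (by fun_prop)
  have key := hC s hs' (fun z => f ((s : ℂ) * z)) hg (by simpa using hf0)
    (T.image fun a => a / (s : ℂ)) fun a ha => by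
      obtain ⟨b, hb, rfl⟩ := Finset.mem_image.1 ha
      rw [mem_ball_zero_iff, norm_div, Complex.norm_real, Real.norm_of_nonneg hs'.1.le,
        div_lt_one hs'.1]
      exact hTs b hb
  rw [Finset.sum_image fun a _ b _ h => (div_left_inj' hsc).1 h] at key
  simp only [analyticOrderNatAt_comp_const_mul f hsc, mul_div_cancel₀ _ hsc, norm_div,
    Complex.norm_real, Real.norm_of_nonneg hs'.1.le] at key
  refine key.trans ?_
  rw [ENNReal.coe_mul, mul_assoc]
  exact mul_le_mul_right (lintegral_le_nevanlinnaNorm hη hqq' hδ hs f) _
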